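/- Let $\mathbb S=\mathbb R\times[0,1]$, equipped with Lebesgue measure $|\cdot|$; a point $(x,u)\in\mathbb S$ has location $x$ and mark $u$. Let $m\ge 0$ be an integer and let $0<\gamma<1$, $0<\gamma'<1/(m+1)$, $\beta>0$ and $0<\lambda,\lambda'<1$. For $p=(x,u)$ and $p'=(z,w)$ in $\mathbb S$ put $F(p,p')=|x-z|\,u^{\gamma}w^{\gamma'}$, and for $\Delta\subseteq\mathbb S$ let $B_F(\Delta,\beta)=\{p'\in\mathbb S: F(p,p')\le\beta\text{ for all }p\in\Delta\}$. Let $\mathcal P$ and $\mathcal P'$ be independent Poisson point processes on $\mathbb S$ with intensity measures $\lambda|\cdot|$ and $\lambda'|\cdot|$, respectively. The set of $m$-simplices is $$\Sigma_m=\{\Delta\subseteq\mathcal P:\ \#\Delta=m+1,\ \mathcal P'\cap B_F(\Delta,\beta)\neq\emptyset\}.$$ For $\Delta\in\Sigma_m$ let $c(\Delta)\in\mathbb R$ be the location of the vertex of $\Delta$ with minimal mark (of the left-most such vertex in case of ties). For a Borel set $A\subseteq\mathbb R$ let $\Sigma_m^A=\{\Delta\in\Sigma_m: c(\Delta)\in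 A\}$, and for $R\subseteq\mathbb S$ and $x\in\mathbb R$ let $R-x=\{(y-x,u):(y,u)\in R\}$. The distribution of the typical $m$-simplex $\Delta_m^*$ is defined, for any Borel set $A$ with $|A|=1$, by $$\mathbb E\big[f(\Delta_m^*,\mathcal P,\mathcal P')\big]=\frac1{\lambda_m}\,\mathbb E\Big[\sum_{\Delta\in\Sigma_m^A}f\big(\Delta-c(\Delta),\,\mathcal P-c(\Delta),\,\mathcal P'-c(\Delta)\big)\Big],\qquad \lambda_m=\mathbb E\big[\#\Sigma_m^A\big],$$ for nonnegative measurable functionals $f$. The higher-order degree of a finite set $\Delta$ is $\deg(\Delta)=\#(\mathcal P'\cap B_F(\Delta,\beta))$, so that $\mathbb P(\deg(\Delta_m^*)\ge k)$ is the right-hand side above with $f(\Delta,\mathcal P,\mathcal P')=\mathbf 1\{\#(\mathcal P'\cap B_F(\Delta,\beta))\ge k\}$. Then, for every Borel set $A\subseteq\mathbb R$ with $|A|=1$ used in this definition, $$\lim_{k\to\infty}\frac{\log\mathbb P\big(\deg(\Delta_m^*)\ge k\big)}{\log k}=m-\frac{m+1}{\gamma}.$$ -/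

import Mathlib

open MeasureTheory ProbabilityTheory Filter Topology
open scoped ENNReal NNReal

namespace RCHM

noncomputable section

/-- The space `𝕊 = ℝ × [0, 1]` of points `(location, mark)`; its `volume` is Lebesgue measure. -/
abbrev Pt : Type := ℝ × unitInterval

/-! ### Connectivity -/

/-- `F((x, u), (z, w)) = |x - z| u ^ γ w ^ γ'`. -/
def F (γ γ' : ℝ) (p p' : Pt) : ℝ :=
  |p.1 - p'.1| * (p.2 : ℝ) ^ γ * (p'.2 : ℝ) ^ γ'

/-- The joint neighbourhood `B_F(Δ, β) = ⋂_{p ∈ Δ} {p' : F(p, p') ≤ β}`. -/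
def nbhd (γ γ' β : ℝ) (Δ : Finset Pt) : Set Pt :=
  {p' | ∀ p ∈ Δ, F γ γ' p p' ≤ β}

/-! ### Point processes -/

/-- Locally finite subsets of `𝕊`. -/
structure Config where
  points : Set Pt
  locallyFinite : ∀ a b : ℝ, (points ∩ {p | p.1 ∈ Set.Icc a b}).Finite

/-- The number of points of a configuration in a set. -/
def Config.count (c : Config) (B : Set Pt) : ℕ∞ := (c.points ∩ B).encard

/-- The usual σ-algebra on configurations, generated by the counts in measurable sets. -/
instance : MeasurableSpace Config :=
  ⨆ (B : Set Pt) (_ : MeasurableSet B), MeasurableSpace.comap (fun c : Config => c.count B) ⊤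

/-- `P` is a Poisson point process on `𝕊` whose intensity measure is `r` times Lebesgue measure:
the count in a measurable set `B` of finite measure is Poisson distributed with mean `r |B|`, and
the counts in disjoint measurable sets are independent. -/
structure IsPoissonProcess {Ω : Type*} [MeasurableSpace Ω] (μ : Measure Ω) (P : Ω → Config)
    (r : ℝ≥0) : Prop where
  measurable : Measurable P
  count_law : ∀ B : Set Pt, MeasurableSet B → volume B ≠ ∞ →
    μ.map (fun ω => (P ω).count B) =
      (poissonMeasure (r * (volume B).toNNReal)).map (fun n : ℕ => (n : ℕ∞))
  count_indep : ∀ (n : ℕ) (B : Fin n → Set Pt), (∀ i, MeasurableSet (B i)) →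
    Pairwise (fun i j => Disjoint (B i) (B j)) →
      iIndepFun (fun (i : Fin n) ω => (P ω).count (B i)) μ

/-! ### Translations of the location coordinate -/

/-- `(y, u) ↦ (y - x, u)`. -/
def shiftPt (x : ℝ) : Pt ≃ Pt := (Equiv.subRight x).prodCongr (Equiv.refl unitInterval)

/-- `Δ - x` for a finite set `Δ`. -/
def shiftFinset (Δ : Finset Pt) (x : ℝ) : Finset Pt := Δ.map (shiftPt x).toEmbedding

/-- `P - x` for a configuration `P`. -/
def Config.shift (c : Config) (x : ℝ) : Config where
  points := shiftPt x '' c.points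
  locallyFinite a b := by
    refine ((c.locallyFinite (a + x) (b + x)).image (shiftPt x)).subset ?_
    rintro _ ⟨⟨p, hp, rfl⟩, h⟩
    refine ⟨p, ⟨hp, ?_⟩, rfl⟩
    have h1 : a ≤ p.1 - x := h.1
    have h2 : p.1 - x ≤ b := h.2
    exact ⟨by linarith, by linarith⟩

/-! ### Simplices, the typical simplex and its degree -/

/-- The `m`-simplices `Σ_m`: the `(m + 1)`-element subsets of `P` with a common neighbour
in `P'`. -/
def simplices (γ γ' β : ℝ) (m : ℕ) (P P' : Config) : Set (Finset Pt) :=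
  {Δ | (Δ : Set Pt) ⊆ P.points ∧ Δ.card = m + 1 ∧ (P'.points ∩ nbhd γ γ' β Δ).Nonempty}

/-- The centre `c(Δ)`: the smallest location among the vertices of minimal mark. -/
def center (Δ : Finset Pt) : ℝ :=
  sInf {x : ℝ | ∃ u : unitInterval, (x, u) ∈ Δ ∧ ∀ q ∈ Δ, u ≤ q.2}

/-- The `m`-simplices with centre in `A`. -/
def simplicesIn (γ γ' β : ℝ) (m : ℕ) (A : Set ℝ) (P P' : Config) : Set (Finset Pt) :=
  {Δ | Δ ∈ simplices γ γ' β m P P' ∧ center Δ ∈ A}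

/-- The `m`-simplex intensity `λ_m = 𝔼[#Σ_m^A]`. -/
def simplexIntensity (γ γ' β : ℝ) (m : ℕ) (A : Set ℝ) {Ω : Type*} [MeasurableSpace Ω]
    (μ : Measure Ω) (P P' : Ω → Config) : ℝ≥0∞ :=
  ∫⁻ ω, ((simplicesIn γ γ' β m A (P ω) (P' ω)).encard : ℝ≥0∞) ∂μ

/-- The distribution of the typical `m`-simplex `Δ*`, as an expectation functional:
`𝔼[f(Δ*, P, P')] = λ_m⁻¹ 𝔼[∑_{Δ ∈ Σ_m^A} f(Δ - c(Δ), P - c(Δ), P' - c(Δ))]`. -/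
def typicalExpectation (γ γ' β : ℝ) (m : ℕ) (A : Set ℝ) {Ω : Type*} [MeasurableSpace Ω]
    (μ : Measure Ω) (P P' : Ω → Config) (f : Finset Pt → Config → Config → ℝ≥0∞) : ℝ≥0∞ :=
  (simplexIntensity γ γ' β m A μ P P')⁻¹ *
    ∫⁻ ω, ∑' Δ : simplicesIn γ γ' β m A (P ω) (P' ω),
      f (shiftFinset Δ.1 (center Δ.1)) ((P ω).shift (center Δ.1)) ((P' ω).shift (center Δ.1)) ∂μ

/-- The higher-order degree of `Δ`: the number of points of `P'` connected to all points
of `Δ`. -/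
def deg (γ γ' β : ℝ) (Δ : Finset Pt) (P' : Config) : ℕ∞ := P'.count (nbhd γ γ' β Δ)

open Classical in
/-- `ℙ(deg(Δ*) ≥ k)` for the typical `m`-simplex `Δ*`. -/
def typicalDegTail (γ γ' β : ℝ) (m : ℕ) (A : Set ℝ) {Ω : Type*} [MeasurableSpace Ω]
    (μ : Measure Ω) (P P' : Ω → Config) (k : ℕ) : ℝ≥0∞ :=
  typicalExpectation γ γ' β m A μ P P'
    (fun Δ _ Q' => if (k : ℕ∞) ≤ deg γ γ' β Δ Q' then 1 else 0)

end

end RCHM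

/-! Degrees are translation invariant, so the tail is `degSum` at k divided by the finite positive
constant `simplexIntensity`. Here `degSum` is the mean number of simplices with centre in A and
degree at least k. It suffices to show that it has order k^(m-(m+1)/γ), since constants disappear
after division by log k (`tendsto_log_div_log`).

The heuristic: a point with mark u has a neighbourhood of volume of order u^(-γ), and the
neighbourhood of Δ lies in that of every vertex. Degree k thus forces each of the m+1 marks to be at
most of order k^(-1/γ), which costs k^(-(m+1)/γ), while the m vertices other than the centre may lie
anywhere within distance of order k, which gains k^m.

Lower bound (`exists_le_degSum`): vertices of such marks in a window of width of order k are joined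
to every point of P' in the window, and with probability at least 1/2 there are k of these.

Upper bound (`exists_degSum_le`): factorial moments bound the Poisson tail by powers of V/k, with V
the volume of the neighbourhood (`measure_le_count_nbhd_le`). One factor V is written as an integral
over a common neighbour, given which the vertices integrate independently
(`lintegral_volume_nbhd_le`); the other factors penalise each mark separately. Each mark integral is
of order k^(1-1/γ), so the total is k^(-1) k^((m+1)(1-1/γ)). The neighbour's mark w contributes the
integral of w^(-γ'(m+1)), finite because γ' < 1/(m+1). Sums over tuples of P become integrals
through `bind_tupleKernel_le` and the independence of P and P'. -/

namespace RCHM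

noncomputable section

/-! ### Sums of Dirac masses over a set -/

/-- The counting measure of a set, as a sum of Dirac masses. -/
def diracSum {α : Type*} [MeasurableSpace α] (s : Set α) : Measure α :=
  Measure.sum fun a : s => Measure.dirac a.1

lemma lintegral_diracSum {α : Type*} [MeasurableSpace α] (s : Set α) {f : α → ℝ≥0∞}
    (hf : Measurable f) : ∫⁻ a, f a ∂(diracSum s) = ∑' a : s, f a := by
  rw [diracSum, lintegral_sum_measure]
  exact tsum_congr fun a => lintegral_dirac' _ hf

lemma diracSum_apply {α : Type*} [MeasurableSpace α] (s : Set α) {B : Set α}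
    (hB : MeasurableSet B) : diracSum s B = ((s ∩ B).encard : ℝ≥0∞) := by
  rw [diracSum, Measure.sum_apply _ hB]
  simp_rw [Measure.dirac_apply' _ hB]
  rw [← ENNReal.tsum_set_one, tsum_subtype s (B.indicator (1 : α → ℝ≥0∞)),
    tsum_subtype (s ∩ B) (fun _ => (1 : ℝ≥0∞))]
  refine tsum_congr fun a => ?_
  rw [Set.indicator_indicator]
  rfl

lemma toENNReal_prod {ι : Type*} (s : Finset ι) (f : ι → ℕ∞) :
    ((∏ i ∈ s, f i : ℕ∞) : ℝ≥0∞) = ∏ i ∈ s, (f i : ℝ≥0∞) :=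
  map_prod ENat.toENNRealRingHom f s

/-! ### A criterion for s-finiteness of a kernel -/

/-- The masses κ a (B n) are finite but need not be bounded in a, so restricting to B n does not
give a finite kernel. Splitting further by the integer part j of the mass bounds each piece by j +
1. The counting kernels below are of this type, and the measurability of their integrals requires
s-finiteness. -/
theorem isSFiniteKernel_of_cover {α β : Type*} [MeasurableSpace α] [MeasurableSpace β]
    (κ : Kernel α β) (B : ℕ → Set β) (hB : ∀ n, MeasurableSet (B n))
    (hfin : ∀ a n, κ a (B n) ≠ ∞) (hcov : ∀ a, κ a (⋃ n, B n)ᶜ = 0) : IsSFiniteKernel κ := by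
  have hD : ∀ n, MeasurableSet (disjointed B n) := fun n => MeasurableSet.disjointed hB n
  have hms : ∀ n j : ℕ, MeasurableSet {a | κ a (disjointed B n) ∈ Set.Ico (j : ℝ≥0∞) (j + 1)} :=
    fun n j => κ.measurable_coe (hD n) measurableSet_Ico
  classical
  let η : ℕ × ℕ → Kernel α β := fun p =>
    Kernel.piecewise (hms p.1 p.2) (κ.restrict (hD p.1)) 0
  have hη : ∀ p, IsFiniteKernel (η p) := by
    intro p
    refine ⟨⟨(p.2 : ℝ≥0∞) + 1, by simp, fun a => ?_⟩⟩
    simp only [η, Kernel.piecewise_apply]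
    split_ifs with h
    · rw [Kernel.restrict_apply, Measure.restrict_apply_univ]
      exact h.2.le
    · simp
  have : κ = Kernel.sum η := by
    ext a s hs
    rw [Kernel.sum_apply' _ _ hs, ENNReal.summable.tsum_prod' fun _ => ENNReal.summable]
    have h1 : ∀ n, ∑' j, η (n, j) a s = κ a (s ∩ disjointed B n) := by
      intro n
      have hlt : κ a (disjointed B n) ≠ ∞ :=
        ne_top_of_le_ne_top (hfin a n) (measure_mono (disjointed_subset B n))
      set x := (κ a (disjointed B n)).toNNReal with hx
      have hxe : κ a (disjointed B n) = x := (ENNReal.coe_toNNReal hlt).symm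
      -- For fixed a exactly one piece is nonzero, the one indexed by the integer part of the mass.
      rw [tsum_eq_single (⌊x⌋₊)]
      · simp only [η, Kernel.piecewise_apply]
        rw [if_pos, Kernel.restrict_apply, Measure.restrict_apply hs]
        simp only [Set.mem_ofPred_eq, hxe, Set.mem_Ico]
        exact ⟨by exact_mod_cast Nat.floor_le (zero_le : 0 ≤ x),
          by exact_mod_cast Nat.lt_floor_add_one x⟩
      · intro j hj
        simp only [η, Kernel.piecewise_apply]
        rw [if_neg]
        · simp
        · simp only [Set.mem_ofPred_eq, hxe, Set.mem_Ico]
          rintro ⟨h1, h2⟩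
          apply hj
          symm
          rw [Nat.floor_eq_iff (zero_le : 0 ≤ x)]
          exact ⟨by exact_mod_cast h1, by exact_mod_cast h2⟩
    simp_rw [h1]
    rw [← measure_iUnion _ (fun n => hs.inter (hD n)), ← Set.inter_iUnion, iUnion_disjointed]
    · rw [← measure_inter_add_sdiff s (MeasurableSet.iUnion hB),
        measure_mono_null (s := s \ ⋃ n, B n) (fun x hx => hx.2) (hcov a), add_zero]
    · intro i j hij
      exact (disjoint_disjointed B hij).mono Set.inter_subset_right Set.inter_subset_right
  rw [this]
  infer_instance

/-! ### The counting kernel -/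

lemma measurable_count {B : Set Pt} (hB : MeasurableSet B) :
    Measurable fun q : Config => q.count B := by
  refine measurable_iff_comap_le.mpr ?_
  exact le_iSup₂_of_le (f := fun (B : Set Pt) (_ : MeasurableSet B) =>
    MeasurableSpace.comap (fun c : Config => c.count B) ⊤) B hB le_rfl

lemma measurable_coe_count {B : Set Pt} (hB : MeasurableSet B) :
    Measurable fun q : Config => (q.count B : ℝ≥0∞) :=
  (measurable_from_top (f := ENat.toENNReal)).comp (measurable_count hB)

lemma Config.count_ne_top (q : Config) {B : Set Pt} {a b : ℝ}
    (hB : B ⊆ {p | p.1 ∈ Set.Icc a b}) : (q.count B : ℝ≥0∞) ≠ ∞ := by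
  have : (q.points ∩ B).Finite :=
    (q.locallyFinite a b).subset (Set.inter_subset_inter_right _ hB)
  simpa [Config.count] using this

/-- The kernel sending a configuration to its counting measure. -/
def countKernel : Kernel Config Pt where
  toFun q := diracSum q.points
  measurable' := by
    rw [Measure.measurable_measure]
    intro s hs
    simp_rw [diracSum_apply _ hs]
    exact measurable_coe_count hs

lemma countKernel_apply (q : Config) {B : Set Pt} (hB : MeasurableSet B) :
    countKernel q B = (q.count B : ℝ≥0∞) := diracSum_apply _ hB

/-- The strip of points with location in `[-n, n]`. -/
def strip (n : ℕ) : Set Pt := {p | p.1 ∈ Set.Icc (-(n : ℝ)) n}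

lemma measurableSet_strip (n : ℕ) : MeasurableSet (strip n) :=
  measurable_fst measurableSet_Icc

lemma exists_mem_strip (p : Pt) : ∃ n, p ∈ strip n := by
  obtain ⟨n, hn⟩ := exists_nat_ge |p.1|
  exact ⟨n, abs_le.mp hn⟩

instance : IsSFiniteKernel countKernel := by
  refine isSFiniteKernel_of_cover _ strip measurableSet_strip (fun q n => ?_) (fun q => ?_)
  · rw [countKernel_apply _ (measurableSet_strip n)]
    exact q.count_ne_top (a := -(n : ℝ)) (b := n) (fun p hp => hp)
  · have : (⋃ n, strip n) = Set.univ := Set.eq_univ_of_forall fun p =>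
      Set.mem_iUnion.mpr (exists_mem_strip p)
    simp [this]

/-! ### Tuples of distinct points -/

/-- The `n`-tuples of distinct points of a configuration. -/
def Config.tuples (q : Config) (n : ℕ) : Set (Fin n → Pt) :=
  {t | Function.Injective t ∧ ∀ i, t i ∈ q.points}

/-- On a product of disjoint sets injectivity is automatic, so counting tuples reduces to
multiplying counts. This is why all later arguments use disjoint boxes. -/
lemma tuples_inter_pi (q : Config) {n : ℕ} {B : Fin n → Set Pt}
    (hd : Pairwise fun i j => Disjoint (B i) (B j)) :
    q.tuples n ∩ Set.univ.pi B = Set.univ.pi fun i => q.points ∩ B i := by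
  ext t
  simp only [Config.tuples, Set.mem_inter_iff, Set.mem_ofPred_eq, Set.mem_univ_pi]
  constructor
  · rintro ⟨⟨-, h1⟩, h2⟩ i
    exact ⟨h1 i, h2 i⟩
  · intro h
    refine ⟨⟨fun i j hij => ?_, fun i => (h i).1⟩, fun i => (h i).2⟩
    by_contra hne
    exact Set.disjoint_left.mp (hd hne) (h i).2 (hij ▸ (h j).2)

lemma diracSum_tuples_pi (q : Config) {n : ℕ} {B : Fin n → Set Pt}
    (hB : ∀ i, MeasurableSet (B i)) (hd : Pairwise fun i j => Disjoint (B i) (B j)) :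
    diracSum (q.tuples n) (Set.univ.pi B) = ∏ i, (q.count (B i) : ℝ≥0∞) := by
  rw [diracSum_apply _ (MeasurableSet.univ_pi hB), tuples_inter_pi q hd,
    Set.encard_pi_eq_prod_encard, toENNReal_prod]
  rfl

/-- Products of disjoint measurable sets with bounded locations, covering the tuples of
distinct points. -/
theorem exists_box_cover (n : ℕ) : ∃ R : ℕ → Fin n → Set Pt,
    (∀ k i, MeasurableSet (R k i)) ∧ (∀ k, Pairwise fun i j => Disjoint (R k i) (R k j)) ∧
    (∀ k i, ∃ a b : ℝ, R k i ⊆ {p | p.1 ∈ Set.Icc a b}) ∧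
    ∀ t : Fin n → Pt, Function.Injective t → t ∈ ⋃ k, Set.univ.pi (R k) := by
  let 𝓑 := TopologicalSpace.countableBasis Pt
  have h𝓑 := TopologicalSpace.isBasis_countableBasis Pt
  let J : Set (Fin n → 𝓑) := {R | (Pairwise fun i j => Disjoint (R i).1 (R j).1) ∧
    ∀ i, ∃ a b : ℝ, (R i).1 ⊆ {p : Pt | p.1 ∈ Set.Icc a b}}
  have key : ∀ t : Fin n → Pt, Function.Injective t →
      ∃ R ∈ J, ∀ i, t i ∈ (R i).1 := by
    intro t ht
    obtain ⟨U, hU, hUd⟩ := (Set.finite_range t).t2_separation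
    -- Basis elements inside separating open sets are disjoint; the unit interval around the
    -- location keeps them bounded.
    have : ∀ i, ∃ v ∈ 𝓑, t i ∈ v ∧ v ⊆ U (t i) ∩ {p : Pt | p.1 ∈ Set.Ioo ((t i).1 - 1) ((t i).1 + 1)} := by
      intro i
      refine h𝓑.exists_subset_of_mem_open ⟨(hU _).1, ?_⟩
        ((hU _).2.inter (isOpen_Ioo.preimage continuous_fst))
      constructor <;> linarith
    choose v hv1 hv2 hv3 using this
    refine ⟨fun i => ⟨v i, hv1 i⟩, ⟨fun i j hij => ?_, fun i => ⟨(t i).1 - 1, (t i).1 + 1, ?_⟩⟩, hv2⟩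
    · exact (hUd ⟨i, rfl⟩ ⟨j, rfl⟩ (ht.ne hij)).mono
        ((hv3 i).trans Set.inter_subset_left) ((hv3 j).trans Set.inter_subset_left)
    · exact ((hv3 i).trans Set.inter_subset_right).trans fun p hp => Set.Ioo_subset_Icc_self hp
  have : Countable 𝓑 := TopologicalSpace.countable_countableBasis Pt
  have hJc : J.Countable := Set.to_countable J
  rcases J.eq_empty_or_nonempty with hJ | hJ
  · refine ⟨fun _ _ => ∅, by simp, fun k i j _ => by simp, fun k i => ⟨0, 0, by simp⟩, ?_⟩
    intro t ht
    obtain ⟨R, hR, -⟩ := key t ht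
    simp [hJ] at hR
  · obtain ⟨f, hf⟩ := hJc.exists_eq_range hJ
    have hfJ : ∀ k, f k ∈ J := fun k => hf ▸ ⟨k, rfl⟩
    refine ⟨fun k i => (f k i).1, fun k i => (h𝓑.isOpen (f k i).2).measurableSet,
      fun k => (hfJ k).1, fun k => (hfJ k).2, fun t ht => ?_⟩
    obtain ⟨R, hR, htR⟩ := key t ht
    rw [hf] at hR
    obtain ⟨k, rfl⟩ := hR
    exact Set.mem_iUnion.mpr ⟨k, fun i _ => htR i⟩

lemma diracSum_tuples_pi_ne_top (q : Config) {n : ℕ} {B : Fin n → Set Pt}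
    (hB : ∀ i, MeasurableSet (B i)) (hd : Pairwise fun i j => Disjoint (B i) (B j))
    (hb : ∀ i, ∃ a b : ℝ, B i ⊆ {p | p.1 ∈ Set.Icc a b}) :
    diracSum (q.tuples n) (Set.univ.pi B) ≠ ∞ := by
  rw [diracSum_tuples_pi q hB hd]
  refine ENNReal.prod_ne_top fun i _ => ?_
  obtain ⟨a, b, hab⟩ := hb i
  exact q.count_ne_top hab

lemma diracSum_tuples_compl (q : Config) {n : ℕ} {S : Set (Fin n → Pt)} (hS : MeasurableSet S)
    (h : ∀ t : Fin n → Pt, Function.Injective t → t ∈ S) :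
    diracSum (q.tuples n) Sᶜ = 0 := by
  rw [diracSum_apply _ hS.compl]
  have : q.tuples n ∩ Sᶜ = ∅ := by
    ext t
    simp only [Set.mem_inter_iff, Set.mem_compl_iff, Set.mem_empty_iff_false, iff_false, not_and,
      not_not]
    exact fun ht => h t ht.1
  simp [this]

/-- Inside one box the measure is finite and its values on rectangles are products of counts, so a
π-system argument gives measurability. The boxes cover all injective tuples, and disjointing them
recovers the whole measure. -/
lemma measurable_diracSum_tuples (n : ℕ) :
    Measurable fun q : Config => diracSum (q.tuples n) := by
  obtain ⟨R, hRm, hRd, hRb, hRc⟩ := exists_box_cover n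
  have hbox : ∀ k, MeasurableSet (Set.univ.pi (R k)) := fun k => MeasurableSet.univ_pi (hRm k)
  have h1 : ∀ k, Measurable fun q : Config =>
      (diracSum (q.tuples n)).restrict (Set.univ.pi (R k)) := by
    intro k
    have : ∀ q : Config, IsFiniteMeasure
        ((diracSum (q.tuples n)).restrict (Set.univ.pi (R k))) := fun q =>
      ⟨by rw [Measure.restrict_apply_univ]
          exact (diracSum_tuples_pi_ne_top q (hRm k) (hRd k) (hRb k)).lt_top⟩
    have hrect : ∀ B : Fin n → Set Pt, (∀ i, MeasurableSet (B i)) → Measurable fun q : Config =>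
        (diracSum (q.tuples n)).restrict (Set.univ.pi (R k)) (Set.univ.pi B) := by
      intro B hB
      have : ∀ q : Config, (diracSum (q.tuples n)).restrict (Set.univ.pi (R k)) (Set.univ.pi B) =
          ∏ i, (q.count (B i ∩ R k i) : ℝ≥0∞) := by
        intro q
        rw [Measure.restrict_apply (MeasurableSet.univ_pi hB), ← Set.pi_inter_distrib,
          diracSum_tuples_pi q (fun i => (hB i).inter (hRm k i))]
        exact fun i j hij => (hRd k hij).mono Set.inter_subset_right Set.inter_subset_right
      simp_rw [this]
      exact Finset.measurable_prod _ fun i _ => measurable_coe_count ((hB i).inter (hRm k i))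
    refine Measurable.measure_of_isPiSystem generateFrom_pi.symm isPiSystem_pi ?_ ?_
    · rintro _ ⟨B, hB, rfl⟩
      exact hrect B fun i => hB i trivial
    · simpa using hrect (fun _ => Set.univ) fun _ => MeasurableSet.univ
  rw [Measure.measurable_measure]
  intro s hs
  have h2 : ∀ q : Config, diracSum (q.tuples n) s =
      ∑' k, (diracSum (q.tuples n)).restrict (Set.univ.pi (R k))
        (s ∩ disjointed (fun k => Set.univ.pi (R k)) k) := by
    intro q
    have hD : ∀ k, MeasurableSet (disjointed (fun k => Set.univ.pi (R k)) k) :=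
      fun k => MeasurableSet.disjointed hbox k
    have h3 : ∀ k, (diracSum (q.tuples n)).restrict (Set.univ.pi (R k))
        (s ∩ disjointed (fun k => Set.univ.pi (R k)) k) =
        diracSum (q.tuples n) (s ∩ disjointed (fun k => Set.univ.pi (R k)) k) := by
      intro k
      rw [Measure.restrict_apply (hs.inter (hD k)), Set.inter_assoc,
        Set.inter_eq_left.mpr (disjointed_subset (fun k => Set.univ.pi (R k)) k)]
    simp_rw [h3]
    rw [← measure_iUnion _ (fun k => hs.inter (hD k)), ← Set.inter_iUnion, iUnion_disjointed]
    · rw [← measure_inter_add_sdiff s (MeasurableSet.iUnion hbox),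
        measure_mono_null (s := s \ _) (fun x hx => hx.2)
          (diracSum_tuples_compl q (MeasurableSet.iUnion hbox) hRc), add_zero]
    · intro i j hij
      exact (disjoint_disjointed _ hij).mono Set.inter_subset_right Set.inter_subset_right
  simp_rw [h2]
  exact Measurable.tsum fun k => (Measure.measurable_coe
    (hs.inter (MeasurableSet.disjointed hbox k))).comp (h1 k)

/-- The kernel sending a configuration to the counting measure on its `n`-tuples of distinct
points. -/
def tupleKernel (n : ℕ) : Kernel Config (Fin n → Pt) where
  toFun q := diracSum (q.tuples n)
  measurable' := measurable_diracSum_tuples n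

lemma tupleKernel_apply (n : ℕ) (q : Config) : tupleKernel n q = diracSum (q.tuples n) := rfl

instance (n : ℕ) : IsSFiniteKernel (tupleKernel n) := by
  obtain ⟨R, hRm, hRd, hRb, hRc⟩ := exists_box_cover n
  refine isSFiniteKernel_of_cover _ (fun k => Set.univ.pi (R k))
    (fun k => MeasurableSet.univ_pi (hRm k)) (fun q k => ?_) (fun q => ?_)
  · exact diracSum_tuples_pi_ne_top q (hRm k) (hRd k) (hRb k)
  · exact diracSum_tuples_compl q
      (MeasurableSet.iUnion fun k => MeasurableSet.univ_pi (hRm k)) hRc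

/-! ### Poisson random variables -/

lemma lintegral_poissonMeasure (r : ℝ≥0) (f : ℕ → ℝ≥0∞) :
    ∫⁻ n, f n ∂(poissonMeasure r) =
      ∑' n, ENNReal.ofReal (Real.exp (-r) * r ^ n / n.factorial) * f n := by
  rw [poissonMeasure, lintegral_sum_measure]
  refine tsum_congr fun n => ?_
  rw [lintegral_smul_measure, lintegral_dirac, smul_eq_mul]

/-- Factorial moments of the Poisson distribution. -/
lemma lintegral_descFactorial_poissonMeasure (r : ℝ≥0) (N : ℕ) :
    ∫⁻ n, (n.descFactorial N : ℝ≥0∞) ∂(poissonMeasure r) = (r : ℝ≥0∞) ^ N := by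
  rw [lintegral_poissonMeasure, ← Summable.sum_add_tsum_nat_add' (k := N) ENNReal.summable]
  rw [Finset.sum_eq_zero, zero_add]
  · have h1 : ∀ n : ℕ, ENNReal.ofReal (Real.exp (-r) * r ^ (n + N) / (n + N).factorial) *
        ((n + N).descFactorial N : ℝ≥0∞) =
        (r : ℝ≥0∞) ^ N * (ENNReal.ofReal (Real.exp (-r) * r ^ n / n.factorial) * 1) := by
      intro n
      rw [mul_one, ← ENNReal.ofReal_natCast, ← ENNReal.ofReal_mul (by positivity),
        ← ENNReal.ofReal_coe_nnreal, ← ENNReal.ofReal_pow (by positivity),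
        ← ENNReal.ofReal_mul (by positivity)]
      congr 1
      have h := Nat.factorial_mul_descFactorial (Nat.le_add_left N n)
      rw [Nat.add_sub_cancel] at h
      have h' : ((n + N).factorial : ℝ) = n.factorial * (n + N).descFactorial N := by
        exact_mod_cast h.symm
      have h2 : ((n + N).descFactorial N : ℝ) ≠ 0 := by
        intro h0
        rw [h0, mul_zero] at h'
        exact (Nat.factorial_ne_zero _) (by exact_mod_cast h')
      rw [h']
      field_simp
      ring
    simp_rw [h1]
    rw [ENNReal.tsum_mul_left, ← lintegral_poissonMeasure r fun _ => 1]
    simp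
  · intro n hn
    rw [Nat.descFactorial_eq_zero_iff_lt.mpr (Finset.mem_range.mp hn)]
    simp

/-- Markov's inequality for the falling factorial, whose Poisson mean is r^N. Polynomial decay of
arbitrary order is all that the upper bound needs. -/
lemma poissonMeasure_Ici_le (r : ℝ≥0) (N k : ℕ) (hk : N ≤ k) :
    poissonMeasure r (Set.Ici k) ≤ (r : ℝ≥0∞) ^ N / (k.descFactorial N : ℝ≥0∞) := by
  have h0 : (k.descFactorial N : ℝ≥0∞) ≠ 0 := by
    simpa [Nat.descFactorial_eq_zero_iff_lt] using hk
  rw [ENNReal.le_div_iff_mul_le (Or.inl h0) (Or.inl (by simp)), mul_comm,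
    ← lintegral_descFactorial_poissonMeasure r N]
  refine le_trans ?_ (mul_meas_ge_le_lintegral Measurable.of_discrete (k.descFactorial N : ℝ≥0∞))
  gcongr
  intro n hn
  simp only [Set.mem_Ici] at hn
  simp only [Set.mem_ofPred_eq]
  exact_mod_cast Nat.descFactorial_le N hn

/-- Chernoff's bound with the test function 2^(-n), whose mean is exp(-r/2). As r/2 ≥ k + 1 and e ≥
2, this mean is at most 2^(-(k+1)). -/
lemma poissonMeasure_Iio_le (r : ℝ≥0) (k : ℕ) (hr : 2 * k + 2 ≤ (r : ℝ)) :
    poissonMeasure r (Set.Iio k) ≤ 1 / 2 := by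
  have h1 : ∫⁻ n, ENNReal.ofReal ((1 / 2 : ℝ) ^ n) ∂(poissonMeasure r) =
      ENNReal.ofReal (Real.exp (-(r / 2))) := by
    rw [lintegral_poissonMeasure]
    have hs := (hasSum_one_poissonMeasure (r / 2)).mul_left (Real.exp (-(r / 2)))
    rw [mul_one] at hs
    rw [← hs.tsum_eq, ENNReal.ofReal_tsum_of_nonneg (fun n => by positivity) hs.summable]
    refine tsum_congr fun n => ?_
    rw [← ENNReal.ofReal_mul (by positivity)]
    congr 1
    have : Real.exp (-(r : ℝ)) = Real.exp (-(r / 2)) * Real.exp (-(r / 2)) := by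
      rw [← Real.exp_add]; ring_nf
    push_cast
    rw [this, div_pow, div_pow]
    ring
  have h2 := mul_meas_ge_le_lintegral (μ := poissonMeasure r)
    (f := fun n => ENNReal.ofReal ((1 / 2 : ℝ) ^ n)) Measurable.of_discrete
    (ENNReal.ofReal ((1 / 2 : ℝ) ^ k))
  rw [h1] at h2
  have h3 : poissonMeasure r (Set.Iio k) ≤
      ENNReal.ofReal (Real.exp (-(r / 2))) / ENNReal.ofReal ((1 / 2 : ℝ) ^ k) := by
    rw [ENNReal.le_div_iff_mul_le (Or.inl (by simp)) (Or.inl (by simp)), mul_comm]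
    refine le_trans ?_ h2
    gcongr
    intro n hn
    simp only [Set.mem_ofPred_eq]
    exact ENNReal.ofReal_le_ofReal
      (pow_le_pow_of_le_one (by norm_num) (by norm_num) (le_of_lt hn))
  refine h3.trans ?_
  rw [← ENNReal.ofReal_div_of_pos (by positivity)]
  have h4 : (1 / 2 : ℝ≥0∞) = ENNReal.ofReal (1 / 2) := by
    rw [ENNReal.ofReal_div_of_pos (by norm_num)]; simp
  rw [h4]
  apply ENNReal.ofReal_le_ofReal
  rw [div_le_iff₀ (by positivity), ← pow_succ']
  have h5 : Real.exp (-(r / 2)) ≤ Real.exp (-1) ^ (k + 1) := by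
    rw [← Real.exp_nat_mul]
    apply Real.exp_le_exp.mpr
    push_cast
    linarith
  refine h5.trans (pow_le_pow_left₀ (by positivity) ?_ _)
  rw [Real.exp_neg, ← one_div]
  have := Real.add_one_le_exp (1 : ℝ)
  gcongr
  linarith

/-! ### Counts of Poisson processes -/

section PoissonCounts

variable {Ω : Type*} [MeasurableSpace Ω] {μ : Measure Ω} {P : Ω → Config} {r : ℝ≥0}

lemma IsPoissonProcess.measurable_count (hP : IsPoissonProcess μ P r) {B : Set Pt}
    (hB : MeasurableSet B) : Measurable fun ω => (P ω).count B :=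
  (RCHM.measurable_count hB).comp hP.measurable

lemma IsPoissonProcess.lintegral_count_comp (hP : IsPoissonProcess μ P r) {B : Set Pt}
    (hB : MeasurableSet B) (hfin : volume B ≠ ∞) (f : ℕ∞ → ℝ≥0∞) :
    ∫⁻ ω, f ((P ω).count B) ∂μ =
      ∫⁻ n : ℕ, f n ∂(poissonMeasure (r * (volume B).toNNReal)) := by
  have h := congrArg (fun ν => ∫⁻ n, f n ∂ν) (hP.count_law B hB hfin)
  rw [lintegral_map Measurable.of_discrete (hP.measurable_count hB),
    lintegral_map Measurable.of_discrete Measurable.of_discrete] at h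
  exact h

lemma IsPoissonProcess.lintegral_count (hP : IsPoissonProcess μ P r) {B : Set Pt}
    (hB : MeasurableSet B) (hfin : volume B ≠ ∞) :
    ∫⁻ ω, ((P ω).count B : ℝ≥0∞) ∂μ = r * volume B := by
  rw [hP.lintegral_count_comp hB hfin (fun n => (n : ℝ≥0∞))]
  have := lintegral_descFactorial_poissonMeasure (r * (volume B).toNNReal) 1
  simp only [Nat.descFactorial_one, pow_one, ENNReal.coe_mul, ENNReal.coe_toNNReal hfin] at this
  simpa using this

lemma IsPoissonProcess.measure_le_count (hP : IsPoissonProcess μ P r) {B : Set Pt}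
    (hB : MeasurableSet B) (hfin : volume B ≠ ∞) (k : ℕ) :
    μ {ω | (k : ℕ∞) ≤ (P ω).count B} =
      poissonMeasure (r * (volume B).toNNReal) (Set.Ici k) := by
  have h := congrArg (fun ν => ν (Set.Ici (k : ℕ∞))) (hP.count_law B hB hfin)
  rw [Measure.map_apply (hP.measurable_count hB) (MeasurableSet.of_discrete),
    Measure.map_apply Measurable.of_discrete (MeasurableSet.of_discrete)] at h
  have e : (fun n : ℕ => (n : ℕ∞)) ⁻¹' Set.Ici (k : ℕ∞) = Set.Ici k := by
    ext n; simp
  rw [e] at h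
  exact h

/-- For infinite volume the count law is silent, but the right-hand side is then ∞ because r and N
are nonzero. Neighbourhoods of infinite volume therefore need no separate treatment later. -/
lemma IsPoissonProcess.measure_le_count_le [IsProbabilityMeasure μ]
    (hP : IsPoissonProcess μ P r) (hr : r ≠ 0) {B : Set Pt}
    (hB : MeasurableSet B) {N k : ℕ} (hN : N ≠ 0) (hk : N ≤ k) :
    μ {ω | (k : ℕ∞) ≤ (P ω).count B} ≤ (r * volume B) ^ N / (k.descFactorial N : ℝ≥0∞) := by
  by_cases hfin : volume B = ∞
  · rw [hfin, ENNReal.mul_top (by simpa using hr), ENNReal.top_pow hN,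
      ENNReal.top_div_of_ne_top (by simp)]
    exact le_top
  · rw [hP.measure_le_count hB hfin]
    refine (poissonMeasure_Ici_le _ N k hk).trans_eq ?_
    rw [ENNReal.coe_mul, ENNReal.coe_toNNReal hfin]

lemma IsPoissonProcess.half_le_measure_le_count
    (hP : IsPoissonProcess μ P r) {B : Set Pt}
    (hB : MeasurableSet B) (hfin : volume B ≠ ∞) {k : ℕ}
    (hk : 2 * k + 2 ≤ (r : ℝ) * (volume B).toReal) :
    1 / 2 ≤ μ {ω | (k : ℕ∞) ≤ (P ω).count B} := by
  rw [hP.measure_le_count hB hfin]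
  have h1 := poissonMeasure_Iio_le (r * (volume B).toNNReal) k (by exact_mod_cast hk)
  have h2 := measure_add_measure_compl (μ := poissonMeasure (r * (volume B).toNNReal))
    (measurableSet_Ici (a := k))
  rw [Set.compl_Ici, measure_univ] at h2
  by_contra! h3
  have h4 := ENNReal.add_lt_add_of_lt_of_le (by finiteness) h3 h1
  rw [h2, ENNReal.add_halves] at h4
  exact lt_irrefl _ h4

/-! ### The factorial moment measure -/

lemma IsPoissonProcess.lintegral_tuples_pi (hP : IsPoissonProcess μ P r) {n : ℕ}
    {B : Fin n → Set Pt} (hB : ∀ i, MeasurableSet (B i))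
    (hd : Pairwise fun i j => Disjoint (B i) (B j)) (hfin : ∀ i, volume (B i) ≠ ∞) :
    ∫⁻ ω, tupleKernel n (P ω) (Set.univ.pi B) ∂μ = ∏ i, (r * volume (B i)) := by
  simp_rw [tupleKernel_apply, diracSum_tuples_pi _ hB hd]
  have h1 : iIndepFun (fun (i : Fin n) ω => ((P ω).count (B i) : ℝ≥0∞)) μ :=
    (hP.count_indep n B hB hd).comp (fun _ => ENat.toENNReal) fun _ => Measurable.of_discrete
  rw [lintegral_prod_eq_prod_lintegral_of_indepFun _ _ h1
    fun i => (measurable_coe_count (hB i)).comp hP.measurable]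
  exact Finset.prod_congr rfl fun i _ => hP.lintegral_count (hB i) (hfin i)

lemma volume_ne_top_of_subset {B : Set Pt} {a b : ℝ} (hB : B ⊆ {p | p.1 ∈ Set.Icc a b}) :
    volume B ≠ ∞ := by
  refine ne_top_of_le_ne_top ?_ (measure_mono hB)
  have : {p : Pt | p.1 ∈ Set.Icc a b} = Set.Icc a b ×ˢ Set.univ := by
    ext p; simp
  rw [this, Measure.volume_eq_prod, Measure.prod_prod]
  simp

/-- The factorial moment measure of a Poisson process is a product measure (the inequality
suffices here). -/
theorem IsPoissonProcess.bind_tupleKernel_le (hP : IsPoissonProcess μ P r) (n : ℕ) :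
    (μ.map P).bind (tupleKernel n) ≤ Measure.pi fun _ : Fin n => r • (volume : Measure Pt) := by
  obtain ⟨R, hRm, hRd, hRb, hRc⟩ := exists_box_cover n
  set ν := (μ.map P).bind (tupleKernel n) with hν
  have hbox : ∀ k, MeasurableSet (Set.univ.pi (R k)) := fun k => MeasurableSet.univ_pi (hRm k)
  have hνa : ∀ S, MeasurableSet S → ν S = ∫⁻ ω, tupleKernel n (P ω) S ∂μ := by
    intro S hS
    rw [hν, Measure.bind_apply hS (tupleKernel n).measurable.aemeasurable,
      lintegral_map ((tupleKernel n).measurable_coe hS) hP.measurable]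
  -- Inside a box both measures agree on rectangles, by independence of counts in disjoint sets;
  -- agreement on each box passes to the union.
  have h1 : ν.restrict (⋃ k, Set.univ.pi (R k)) =
      (Measure.pi fun _ : Fin n => r • (volume : Measure Pt)).restrict
        (⋃ k, Set.univ.pi (R k)) := by
    rw [Measure.restrict_iUnion_congr]
    intro k
    rw [Measure.restrict_pi_pi]
    symm
    apply Measure.pi_eq
    intro B hB
    rw [Measure.restrict_apply (MeasurableSet.univ_pi hB), ← Set.pi_inter_distrib,
      hνa _ (MeasurableSet.univ_pi fun i => (hB i).inter (hRm k i)),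
      hP.lintegral_tuples_pi (fun i => (hB i).inter (hRm k i))]
    · refine Finset.prod_congr rfl fun i _ => ?_
      rw [Measure.restrict_apply (hB i)]
      rfl
    · exact fun i j hij => (hRd k hij).mono Set.inter_subset_right Set.inter_subset_right
    · intro i
      obtain ⟨a, b, hab⟩ := hRb k i
      exact volume_ne_top_of_subset (Set.inter_subset_right.trans hab)
  -- The moment measure charges only injective tuples, which the boxes cover. For the product
  -- measure the restriction is simply dropped, hence an inequality.
  have h2 : ν = ν.restrict (⋃ k, Set.univ.pi (R k)) := by
    symm
    apply Measure.restrict_eq_self_of_ae_mem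
    rw [ae_iff]
    change ν (⋃ k, Set.univ.pi (R k))ᶜ = 0
    rw [hνa _ (MeasurableSet.iUnion hbox).compl]
    simp_rw [tupleKernel_apply, diracSum_tuples_compl _ (MeasurableSet.iUnion hbox) hRc]
    simp
  rw [h2, h1]
  exact Measure.restrict_le_self

end PoissonCounts

/-! ### Integrals of products and of powers -/

lemma lintegral_pi_prod {α : Type*} [MeasurableSpace α] (μ : Measure α) [SigmaFinite μ] {n : ℕ}
    (f : Fin n → α → ℝ≥0∞) (hf : ∀ i, Measurable (f i)) :
    ∫⁻ t, ∏ i, f i (t i) ∂(Measure.pi fun _ : Fin n => μ) = ∏ i, ∫⁻ a, f i a ∂μ := by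
  induction n with
  | zero => simp
  | succ n ih =>
    have e := (measurePreserving_piFinSuccAbove (fun _ : Fin (n + 1) => μ) 0).symm
    have hm : Measurable fun t : Fin (n + 1) → α => ∏ i, f i (t i) :=
      Finset.measurable_prod _ fun i _ => (hf i).comp (measurable_pi_apply i)
    rw [← e.lintegral_comp hm]
    simp only [Fin.prod_univ_succ]
    rw [← ih (fun i => f i.succ) fun i => hf i.succ]
    rw [← lintegral_prod_mul (hf 0).aemeasurable]
    · rfl
    · exact (Finset.measurable_prod _
        fun i _ => (hf i.succ).comp (measurable_pi_apply i)).aemeasurable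

lemma lintegral_Ioc_rpow {s b : ℝ} (hs : s < 1) (hb : 0 ≤ b) :
    ∫⁻ u in Set.Ioc 0 b, ENNReal.ofReal (u ^ (-s)) = ENNReal.ofReal (b ^ (1 - s) / (1 - s)) := by
  have hi : IntervalIntegrable (fun u : ℝ => u ^ (-s)) volume 0 b :=
    intervalIntegral.intervalIntegrable_rpow' (by linarith)
  rw [intervalIntegrable_iff_integrableOn_Ioc_of_le hb] at hi
  rw [← ofReal_integral_eq_lintegral_ofReal hi, ← intervalIntegral.integral_of_le hb,
    integral_rpow (Or.inl (by linarith)), Real.zero_rpow (by linarith)]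
  · congr 1
    rw [sub_zero, neg_add_eq_sub]
  · filter_upwards [ae_restrict_mem measurableSet_Ioc] with u hu
    exact Real.rpow_nonneg hu.1.le _

lemma lintegral_Ioi_rpow {s b : ℝ} (hs : 1 < s) (hb : 0 < b) :
    ∫⁻ u in Set.Ioi b, ENNReal.ofReal (u ^ (-s)) = ENNReal.ofReal (b ^ (1 - s) / (s - 1)) := by
  rw [← ofReal_integral_eq_lintegral_ofReal (integrableOn_Ioi_rpow_of_lt (by linarith) hb),
    integral_Ioi_rpow_of_lt (by linarith) hb]
  · congr 1
    rw [neg_add_eq_sub, neg_div, ← div_neg, neg_sub]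
  · filter_upwards [ae_restrict_mem measurableSet_Ioi] with u hu
    exact Real.rpow_nonneg (hb.trans hu).le _

/-- The weight `u ^ (-γ)` of a mark, with value `∞` at `u = 0`. -/
def weight (γ : ℝ) (u : unitInterval) : ℝ≥0∞ := (ENNReal.ofReal ((u : ℝ) ^ γ))⁻¹

lemma measurable_weight (γ : ℝ) : Measurable (weight γ) := by
  unfold weight
  fun_prop

lemma weight_of_pos {γ : ℝ} {u : unitInterval} (hu : 0 < (u : ℝ)) :
    weight γ u = ENNReal.ofReal ((u : ℝ) ^ (-γ)) := by
  rw [weight, ← ENNReal.ofReal_inv_of_pos (by positivity), Real.rpow_neg hu.le]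

lemma ae_pos_unitInterval : ∀ᵐ u : unitInterval, 0 < (u : ℝ) := by
  have : ∀ᵐ u : unitInterval, u ≠ 0 := by
    rw [ae_iff]; simp
  filter_upwards [this] with u hu
  exact lt_of_le_of_ne u.2.1 fun h => hu (Subtype.ext h.symm)

lemma lintegral_unitInterval_le {f : unitInterval → ℝ≥0∞} {g : ℝ → ℝ≥0∞} (hg : Measurable g)
    (h : ∀ u : unitInterval, 0 < (u : ℝ) → f u ≤ g u) :
    ∫⁻ u, f u ≤ ∫⁻ u in Set.Ioc (0 : ℝ) 1, g u := by
  calc ∫⁻ u, f u ≤ ∫⁻ u : unitInterval, g u := by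
        refine lintegral_mono_ae ?_
        filter_upwards [ae_pos_unitInterval] with u hu using h u hu
    _ = ∫⁻ u in unitInterval, g u := unitInterval.measurePreserving_coe.lintegral_comp hg
    _ = ∫⁻ u in Set.Ioc (0 : ℝ) 1, g u := by
        rw [unitInterval, restrict_Ioc_eq_restrict_Icc]

/-- Applied to γ' with n = m + 1, this is where the hypothesis γ' < 1/(m+1) enters. -/
lemma lintegral_weight_pow_ne_top {γ : ℝ} {n : ℕ} (h : γ * n < 1) :
    ∫⁻ u, weight γ u ^ n ≠ ∞ := by
  refine ne_top_of_le_ne_top ?_ (lintegral_unitInterval_le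
    (g := fun u => ENNReal.ofReal (u ^ (-(γ * n)))) (by fun_prop) fun u hu => ?_)
  · rw [lintegral_Ioc_rpow h zero_le_one]
    exact ENNReal.ofReal_ne_top
  · rw [weight_of_pos hu, ← ENNReal.ofReal_pow (by positivity), ← Real.rpow_natCast,
      ← Real.rpow_mul hu.le, neg_mul]

/-- Split at t = k^(-1/γ), where u^(-γ) = k. Below t the minimum is replaced by 1 and the integral
of u^(-γ) has order t^(1-γ). Above t the integrand is at most (D/k)^M u^(-γ(M+1)), integrable at
infinity because γ(M+1) > 1. Both parts have order k^(1-1/γ). -/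
lemma lintegral_weight_mul_min_pow_le {γ : ℝ} (hγ0 : 0 < γ) (hγ1 : γ < 1) (D : ℝ≥0) {M : ℕ}
    (hM : 1 < γ * (M + 1)) : ∃ C : ℝ, 0 < C ∧ ∀ k : ℕ, 0 < k →
      ∫⁻ u, weight γ u * (min 1 (D * weight γ u / k)) ^ M ≤
        ENNReal.ofReal (C * (k : ℝ) ^ (1 - 1 / γ)) := by
  refine ⟨1 / (1 - γ) + (D : ℝ) ^ M / (γ * (M + 1) - 1), ?_, fun k hk => ?_⟩
  · have h1 : 0 < 1 - γ := by linarith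
    have h2 : 0 < γ * (M + 1) - 1 := by linarith
    positivity
  have h1 : 0 < 1 - γ := by linarith
  have h2 : 0 < γ * (M + 1) - 1 := by linarith
  have hk' : (0 : ℝ) < k := by exact_mod_cast hk
  set t : ℝ := (k : ℝ) ^ (-(1 / γ)) with ht
  have ht0 : 0 < t := by positivity
  let g1 : ℝ → ℝ≥0∞ := (Set.Ioc 0 t).indicator fun u => ENNReal.ofReal (u ^ (-γ))
  let g2 : ℝ → ℝ≥0∞ := (Set.Ioi t).indicator fun u =>
    ENNReal.ofReal ((D / k : ℝ) ^ M) * ENNReal.ofReal (u ^ (-(γ * (M + 1))))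
  have hg1 : Measurable g1 := Measurable.indicator (by fun_prop) measurableSet_Ioc
  have hg2 : Measurable g2 := Measurable.indicator (by fun_prop) measurableSet_Ioi
  calc ∫⁻ u, weight γ u * (min 1 (D * weight γ u / k)) ^ M
      ≤ ∫⁻ u in Set.Ioc (0 : ℝ) 1, (g1 u + g2 u) := by
        refine lintegral_unitInterval_le (hg1.add hg2) fun u hu => ?_
        rw [weight_of_pos hu]
        rcases le_or_gt (u : ℝ) t with hut | hut
        · refine le_trans ?_ le_self_add
          simp only [g1]
          rw [Set.indicator_of_mem (show (u : ℝ) ∈ Set.Ioc 0 t from ⟨hu, hut⟩)]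
          exact mul_le_of_le_one_right' (pow_le_one' (min_le_left _ _) _)
        · refine le_trans ?_ le_add_self
          simp only [g2]
          rw [Set.indicator_of_mem (show (u : ℝ) ∈ Set.Ioi t from hut)]
          refine (mul_le_mul_right (pow_le_pow_left' (min_le_right _ _) _) _).trans_eq ?_
          rw [← ENNReal.ofReal_natCast, ← ENNReal.ofReal_coe_nnreal,
            ← ENNReal.ofReal_mul (by positivity), ← ENNReal.ofReal_div_of_pos hk',
            ← ENNReal.ofReal_pow (by positivity), ← ENNReal.ofReal_mul (by positivity),
            ← ENNReal.ofReal_mul (by positivity)]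
          congr 1
          have : (u : ℝ) ^ (-(γ * (M + 1))) = (u : ℝ) ^ (-γ) * ((u : ℝ) ^ (-γ)) ^ M := by
            rw [← Real.rpow_natCast, ← Real.rpow_mul hu.le, ← Real.rpow_add hu]
            congr 1; ring
          rw [this, mul_div_right_comm, mul_pow]
          ring
    _ ≤ ∫⁻ u, (g1 u + g2 u) := setLIntegral_le_lintegral _ _
    _ = ENNReal.ofReal (t ^ (1 - γ) / (1 - γ)) + ENNReal.ofReal ((D / k : ℝ) ^ M) *
          ENNReal.ofReal (t ^ (1 - γ * (M + 1)) / (γ * (M + 1) - 1)) := by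
        rw [lintegral_add_left hg1]
        simp only [g1, g2]
        rw [lintegral_indicator measurableSet_Ioc, lintegral_indicator measurableSet_Ioi,
          lintegral_const_mul _ (by fun_prop), lintegral_Ioc_rpow hγ1 ht0.le,
          lintegral_Ioi_rpow hM ht0]
    _ = ENNReal.ofReal ((1 / (1 - γ) + (D : ℝ) ^ M / (γ * (M + 1) - 1)) *
          (k : ℝ) ^ (1 - 1 / γ)) := by
        rw [← ENNReal.ofReal_mul (by positivity), ← ENNReal.ofReal_add (by positivity)
          (by positivity)]
        congr 1
        have e1 : t ^ (1 - γ) = (k : ℝ) ^ (1 - 1 / γ) := by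
          rw [ht, ← Real.rpow_mul hk'.le]
          congr 1; field_simp; ring
        have e2 : t ^ (1 - γ * (M + 1)) = (k : ℝ) ^ (1 - 1 / γ) * (k : ℝ) ^ M := by
          rw [ht, ← Real.rpow_mul hk'.le, ← Real.rpow_natCast, ← Real.rpow_add hk']
          congr 1; field_simp; ring
        rw [e1, e2, div_pow]
        field_simp

/-! ### Neighbourhoods -/

section Geometry

variable {γ γ' β : ℝ}

lemma measurable_F (γ γ' : ℝ) : Measurable fun x : Pt × Pt => F γ γ' x.1 x.2 := by
  unfold F
  fun_prop

/-- The set of pairs of connected points. -/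
def connected (γ γ' β : ℝ) : Set (Pt × Pt) := {x | F γ γ' x.1 x.2 ≤ β}

lemma measurableSet_connected (γ γ' β : ℝ) : MeasurableSet (connected γ γ' β) :=
  measurableSet_le (measurable_F γ γ') measurable_const

lemma measurableSet_nbhd (γ γ' β : ℝ) (Δ : Finset Pt) : MeasurableSet (nbhd γ γ' β Δ) := by
  have : nbhd γ γ' β Δ = ⋂ p ∈ Δ, Prod.mk p ⁻¹' connected γ γ' β := by
    ext p'
    simp [nbhd, connected]
  rw [this]
  exact Finset.measurableSet_biInter _
    fun p _ => measurable_prodMk_left (measurableSet_connected γ γ' β)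

lemma volume_abs_sub_mul_le (hβ : 0 < β) {c : ℝ} (hc : 0 ≤ c) (z : ℝ) :
    volume {x : ℝ | |x - z| * c ≤ β} ≤ ENNReal.ofReal (2 * β) * (ENNReal.ofReal c)⁻¹ := by
  rcases hc.eq_or_lt with rfl | hc
  · rw [ENNReal.ofReal_zero, ENNReal.inv_zero, ENNReal.mul_top (by simpa using hβ)]
    exact le_top
  · have : {x : ℝ | |x - z| * c ≤ β} = Set.Icc (z - β / c) (z + β / c) := by
      ext x
      simp only [Set.mem_ofPred_eq, Set.mem_Icc]
      rw [← le_div_iff₀ hc, abs_le]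
      constructor <;> rintro ⟨h1, h2⟩ <;> constructor <;> linarith
    rw [this, Real.volume_Icc, ← ENNReal.ofReal_inv_of_pos hc,
      ← ENNReal.ofReal_mul (by positivity)]
    apply ENNReal.ofReal_le_ofReal
    apply le_of_eq
    field_simp
    ring

lemma weight_mul (γ γ' : ℝ) (u w : unitInterval) :
    (ENNReal.ofReal ((u : ℝ) ^ γ * (w : ℝ) ^ γ'))⁻¹ = weight γ u * weight γ' w := by
  rw [ENNReal.ofReal_mul (Real.rpow_nonneg u.2.1 _), ENNReal.mul_inv (by simp) (by simp)]
  rfl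

lemma lintegral_connected_left_le (hβ : 0 < β) (z : ℝ) (u w : unitInterval) :
    ∫⁻ x : ℝ, (connected γ γ' β).indicator 1 ((x, u), (z, w)) ≤
      ENNReal.ofReal (2 * β) * weight γ u * weight γ' w := by
  have hm : Measurable fun x : ℝ => (((x, u), (z, w)) : Pt × Pt) := by fun_prop
  change ∫⁻ x : ℝ, ((fun x : ℝ => (((x, u), (z, w)) : Pt × Pt)) ⁻¹'
    (connected γ γ' β)).indicator 1 x ≤ _
  rw [lintegral_indicator_one (hm (measurableSet_connected γ γ' β)), mul_assoc, ← weight_mul]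
  refine le_trans (le_of_eq ?_) (volume_abs_sub_mul_le hβ (mul_nonneg
    (Real.rpow_nonneg u.2.1 _) (Real.rpow_nonneg w.2.1 _)) z)
  congr 1
  ext x
  simp [connected, F, mul_assoc]

lemma lintegral_connected_right_le (hβ : 0 < β) (x : ℝ) (u w : unitInterval) :
    ∫⁻ z : ℝ, (connected γ γ' β).indicator 1 ((x, u), (z, w)) ≤
      ENNReal.ofReal (2 * β) * weight γ u * weight γ' w := by
  refine le_trans (le_of_eq ?_) (lintegral_connected_left_le (γ := γ) (γ' := γ') hβ x u w)
  refine lintegral_congr fun z => ?_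
  have h : (((x, u), (z, w)) : Pt × Pt) ∈ connected γ γ' β ↔
      (((z, u), (x, w)) : Pt × Pt) ∈ connected γ γ' β := by
    simp [connected, F, abs_sub_comm]
  classical
  simp only [Set.indicator_apply, h, Pi.one_apply]

lemma measurable_connected_indicator (γ γ' β : ℝ) :
    Measurable ((connected γ γ' β).indicator (1 : Pt × Pt → ℝ≥0∞)) :=
  measurable_one.indicator (measurableSet_connected γ γ' β)

/-- A joint neighbourhood lies in the neighbourhood of any single vertex, so every mark separately
limits its volume. -/
lemma volume_nbhd_le (hβ : 0 < β) {Δ : Finset Pt} {p : Pt} (hp : p ∈ Δ) :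
    volume (nbhd γ γ' β Δ) ≤
      ENNReal.ofReal (2 * β) * (∫⁻ w, weight γ' w) * weight γ p.2 := by
  have h1 : nbhd γ γ' β Δ ⊆ Prod.mk p ⁻¹' connected γ γ' β := fun p' h => h p hp
  refine (measure_mono h1).trans ?_
  rw [← lintegral_indicator_one (measurable_prodMk_left (measurableSet_connected γ γ' β)),
    Measure.volume_eq_prod, lintegral_prod_symm' _
      (measurable_one.indicator (measurable_prodMk_left (measurableSet_connected γ γ' β)))]
  calc _ ≤ ∫⁻ w : unitInterval, ENNReal.ofReal (2 * β) * weight γ p.2 * weight γ' w :=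
        lintegral_mono fun w => lintegral_connected_right_le hβ p.1 p.2 w
    _ = _ := by
        rw [lintegral_const_mul _ (measurable_weight γ')]
        ring

lemma lintegral_connected_mark_le (hβ : 0 < β) {G : unitInterval → ℝ≥0∞} (hG : Measurable G)
    (p' : Pt) :
    ∫⁻ p : Pt, (connected γ γ' β).indicator 1 (p, p') * G p.2 ≤
      ENNReal.ofReal (2 * β) * (∫⁻ u, weight γ u * G u) * weight γ' p'.2 := by
  have hm : Measurable fun p : Pt => (connected γ γ' β).indicator (1 : Pt × Pt → ℝ≥0∞) (p, p') * G p.2 :=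
    ((measurable_connected_indicator γ γ' β).comp measurable_prodMk_right).mul
      (hG.comp measurable_snd)
  rw [Measure.volume_eq_prod, lintegral_prod_symm' _ hm]
  calc _ ≤ ∫⁻ u : unitInterval, (ENNReal.ofReal (2 * β) * weight γ' p'.2) * (weight γ u * G u) := by
        refine lintegral_mono fun u => ?_
        dsimp only
        have hc : Measurable fun x : ℝ =>
            (connected γ γ' β).indicator (1 : Pt × Pt → ℝ≥0∞) ((x, u), p') :=
          (measurable_connected_indicator γ γ' β).comp (by fun_prop)
        rw [lintegral_mul_const _ hc]
        refine (mul_le_mul_left (lintegral_connected_left_le hβ p'.1 u p'.2) _).trans_eq ?_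
        ring
    _ = _ := by
        have hw : Measurable fun u => weight γ u * G u := (measurable_weight γ).mul hG
        rw [lintegral_const_mul _ hw]
        ring

/-- With the vertex pinned to A, the location z of the neighbour can be integrated out first; the
location of the vertex then contributes the volume of A. -/
lemma lintegral_connected_fst_le (hβ : 0 < β) {G : unitInterval → ℝ≥0∞} (hG : Measurable G)
    {A : Set ℝ} (hA : MeasurableSet A) (w : unitInterval) :
    ∫⁻ z : ℝ, ∫⁻ p : Pt, (connected γ γ' β).indicator 1 (p, (z, w)) *
        (G p.2 * A.indicator 1 p.1) ≤
      ENNReal.ofReal (2 * β) * (∫⁻ u, weight γ u * G u) * weight γ' w * volume A := by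
  have hGA : Measurable fun p : Pt => G p.2 * A.indicator (1 : ℝ → ℝ≥0∞) p.1 :=
    (hG.comp measurable_snd).mul ((measurable_one.indicator hA).comp measurable_fst)
  have hm : Measurable (Function.uncurry fun (z : ℝ) (p : Pt) =>
      (connected γ γ' β).indicator (1 : Pt × Pt → ℝ≥0∞) (p, (z, w)) * (G p.2 * A.indicator 1 p.1)) :=
    ((measurable_connected_indicator γ γ' β).comp (by fun_prop)).mul (hGA.comp measurable_snd)
  rw [lintegral_lintegral_swap hm.aemeasurable]
  calc _ ≤ ∫⁻ p : Pt, (ENNReal.ofReal (2 * β) * weight γ' w) *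
          (A.indicator 1 p.1 * (weight γ p.2 * G p.2)) := by
        refine lintegral_mono fun p => ?_
        dsimp only
        have hc : Measurable fun z : ℝ =>
            (connected γ γ' β).indicator (1 : Pt × Pt → ℝ≥0∞) (p, (z, w)) :=
          (measurable_connected_indicator γ γ' β).comp (by fun_prop)
        rw [lintegral_mul_const _ hc]
        refine (mul_le_mul_left (lintegral_connected_right_le hβ p.1 p.2 w) _).trans_eq ?_
        ring
    _ = _ := by
        have hw : Measurable fun u => weight γ u * G u := (measurable_weight γ).mul hG
        have hA' : Measurable (A.indicator (1 : ℝ → ℝ≥0∞)) := measurable_one.indicator hA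
        have hAw : Measurable fun p : Pt =>
            A.indicator (1 : ℝ → ℝ≥0∞) p.1 * (weight γ p.2 * G p.2) :=
          (hA'.comp measurable_fst).mul (hw.comp measurable_snd)
        rw [lintegral_const_mul _ hAw, Measure.volume_eq_prod,
          lintegral_prod_mul (f := A.indicator 1) (g := fun u => weight γ u * G u)
            hA'.aemeasurable hw.aemeasurable, lintegral_indicator_one hA]
        ring

/-- The vertices of a tuple. -/
def vertices {n : ℕ} (t : Fin n → Pt) : Finset Pt := Finset.univ.image t

lemma mem_vertices {n : ℕ} {t : Fin n → Pt} {p : Pt} : p ∈ vertices t ↔ ∃ i, t i = p := by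
  simp [vertices]

lemma nbhd_vertices_indicator {n : ℕ} (t : Fin n → Pt) (p' : Pt) :
    (nbhd γ γ' β (vertices t)).indicator (1 : Pt → ℝ≥0∞) p' =
      ∏ i, (connected γ γ' β).indicator 1 (t i, p') := by
  classical
  have h : p' ∈ nbhd γ γ' β (vertices t) ↔ ∀ i, (t i, p') ∈ connected γ γ' β := by
    simp [nbhd, vertices, connected]
  by_cases hp : p' ∈ nbhd γ γ' β (vertices t)
  · rw [Set.indicator_of_mem hp, Finset.prod_eq_one]
    · rfl
    · intro i _
      rw [Set.indicator_of_mem (h.mp hp i)]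
      rfl
  · rw [Set.indicator_of_notMem hp]
    have := mt h.mpr hp
    push Not at this
    obtain ⟨i, hi⟩ := this
    exact (Finset.prod_eq_zero (Finset.mem_univ i) (Set.indicator_of_notMem hi _)).symm

/-- Given the common neighbour p', the conditions on the vertices decouple, so Tonelli's theorem
factorises the integral. -/
lemma lintegral_pi_lintegral_prod {α δ : Type*} [MeasurableSpace α] [MeasurableSpace δ]
    (ν : Measure α) [SigmaFinite ν] (ρ : Measure δ) [SFinite ρ] {n : ℕ}
    {φ : δ → Fin n → α → ℝ≥0∞} (hφ : ∀ i, Measurable fun x : δ × α => φ x.1 i x.2) :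
    ∫⁻ t : Fin n → α, (∫⁻ p', ∏ i, φ p' i (t i) ∂ρ) ∂(Measure.pi fun _ => ν) =
      ∫⁻ p', (∏ i, ∫⁻ p, φ p' i p ∂ν) ∂ρ := by
  have hprod : Measurable fun x : (Fin n → α) × δ => ∏ i, φ x.2 i (x.1 i) := by
    refine Finset.measurable_prod _ fun i _ => ?_
    have hi : Measurable fun x : (Fin n → α) × δ => (x.2, x.1 i) := by fun_prop
    exact (hφ i).comp hi
  rw [lintegral_lintegral_swap hprod.aemeasurable]
  exact lintegral_congr fun p' => lintegral_pi_prod ν (φ p')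
    fun i => (hφ i).comp measurable_prodMk_left

/-- The mean number of pairs of a tuple, with one vertex in `A`, and a common neighbour. -/
theorem lintegral_volume_nbhd_le (hβ : 0 < β) {m : ℕ} {G : unitInterval → ℝ≥0∞}
    (hG : Measurable G) {A : Set ℝ} (hA : MeasurableSet A) (j : Fin (m + 1)) :
    ∫⁻ t : Fin (m + 1) → Pt, A.indicator 1 (t j).1 *
        (volume (nbhd γ γ' β (vertices t)) * ∏ i, G (t i).2)
          ∂(Measure.pi fun _ => (volume : Measure Pt)) ≤
      (ENNReal.ofReal (2 * β) * ∫⁻ u, weight γ u * G u) ^ (m + 1) * volume A *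
        ∫⁻ w, weight γ' w ^ (m + 1) := by
  set H := ENNReal.ofReal (2 * β) * ∫⁻ u, weight γ u * G u with hH
  -- The indicator of A is absorbed into the j-th factor so that the integrand is a product over
  -- vertices.
  let φ : Pt → Fin (m + 1) → Pt → ℝ≥0∞ := fun p' i p =>
    (connected γ γ' β).indicator 1 (p, p') *
      (G p.2 * if i = j then A.indicator 1 p.1 else 1)
  have hφ' : ∀ i, Measurable fun x : Pt × Pt => φ x.1 i x.2 := by
    intro i
    refine ((measurable_connected_indicator γ γ' β).comp measurable_swap).mul
      (Measurable.mul (hG.comp (by fun_prop)) ?_)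
    split_ifs
    · exact (measurable_one.indicator hA).comp (by fun_prop)
    · exact measurable_const
  calc _ = ∫⁻ t : Fin (m + 1) → Pt, (∫⁻ p' : Pt, ∏ i, φ p' i (t i))
          ∂(Measure.pi fun _ => (volume : Measure Pt)) := by
        refine lintegral_congr fun t => ?_
        have hN : Measurable ((nbhd γ γ' β (vertices t)).indicator (1 : Pt → ℝ≥0∞)) :=
          measurable_one.indicator (measurableSet_nbhd γ γ' β _)
        rw [show volume (nbhd γ γ' β (vertices t)) =
            ∫⁻ p', (nbhd γ γ' β (vertices t)).indicator (1 : Pt → ℝ≥0∞) p' from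
          (lintegral_indicator_one (measurableSet_nbhd γ γ' β _)).symm,
          ← lintegral_mul_const _ hN, ← lintegral_const_mul _ (hN.mul_const _)]
        refine lintegral_congr fun p' => ?_
        rw [nbhd_vertices_indicator]
        simp only [φ, Finset.prod_mul_distrib, Finset.prod_ite_eq', Finset.mem_univ, if_true]
        ring
    _ = ∫⁻ p' : Pt, ∏ i, ∫⁻ p, φ p' i p := lintegral_pi_lintegral_prod volume volume hφ'
    -- The m free vertices are bounded uniformly in the location of p'. The j-th factor is kept: it
    -- alone makes the integral over that location converge.
    _ ≤ ∫⁻ p' : Pt, (H * weight γ' p'.2) ^ m * ∫⁻ p, φ p' j p := by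
        refine lintegral_mono fun p' => ?_
        dsimp only
        rw [← Finset.prod_erase_mul _ _ (Finset.mem_univ j)]
        gcongr
        refine (Finset.prod_le_prod' (g := fun _ => H * weight γ' p'.2) fun i hi => ?_).trans_eq ?_
        · have hij : i ≠ j := Finset.ne_of_mem_erase hi
          simp only [φ, if_neg hij, mul_one]
          exact lintegral_connected_mark_le hβ hG p'
        · rw [Finset.prod_const, Finset.card_erase_of_mem (Finset.mem_univ j)]
          simp
    _ = ∫⁻ w : unitInterval, ∫⁻ z : ℝ, (H * weight γ' w) ^ m * ∫⁻ p, φ (z, w) j p := by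
        rw [Measure.volume_eq_prod, lintegral_prod_symm']
        refine Measurable.mul ?_ ?_
        · exact (((measurable_weight γ').comp measurable_snd).const_mul _).pow_const _
        · exact (hφ' j).lintegral_prod_right'
    _ ≤ ∫⁻ w : unitInterval, (H ^ (m + 1) * volume A) * weight γ' w ^ (m + 1) := by
        refine lintegral_mono fun w => ?_
        dsimp only
        rw [lintegral_const_mul]
        · simp only [φ, if_true]
          refine (mul_le_mul_right (lintegral_connected_fst_le hβ hG hA w) _).trans_eq ?_
          rw [← hH]
          ring
        · exact (hφ' j).lintegral_prod_right'.comp (by fun_prop)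
    _ = _ := by
        rw [lintegral_const_mul _ ((measurable_weight γ').pow_const _)]

end Geometry

/-! ### Simplices and tuples -/

section Simplices

variable {γ γ' β : ℝ} {m : ℕ} {A : Set ℝ}

lemma F_shift (γ γ' x : ℝ) (p p' : Pt) :
    F γ γ' (shiftPt x p) (shiftPt x p') = F γ γ' p p' := by
  simp [F, shiftPt]

lemma deg_shift (γ γ' β : ℝ) (Δ : Finset Pt) (q : Config) (x : ℝ) :
    deg γ γ' β (shiftFinset Δ x) (q.shift x) = deg γ γ' β Δ q := by
  have h : (q.shift x).points ∩ nbhd γ γ' β (shiftFinset Δ x) =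
      shiftPt x '' (q.points ∩ nbhd γ γ' β Δ) := by
    ext p'
    constructor
    · rintro ⟨⟨p, hp, rfl⟩, h2⟩
      refine ⟨p, ⟨hp, fun v hv => ?_⟩, rfl⟩
      rw [← F_shift γ γ' x]
      exact h2 _ (Finset.mem_map_of_mem _ hv)
    · rintro ⟨p, ⟨hp, h2⟩, rfl⟩
      refine ⟨⟨p, hp, rfl⟩, fun v hv => ?_⟩
      obtain ⟨v', hv', rfl⟩ := Finset.mem_map.mp hv
      exact (F_shift γ γ' x v' p).trans_le (h2 v' hv')
  rw [deg, deg, Config.count, Config.count, h, (shiftPt x).injective.encard_image]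

open Classical in
/-- The indicator of the event that `Δ` has degree at least `k`. -/
def degInd (γ γ' β : ℝ) (k : ℕ) (Δ : Finset Pt) (q' : Config) : ℝ≥0∞ :=
  if (k : ℕ∞) ≤ deg γ γ' β Δ q' then 1 else 0

/-- The mean number of simplices with centre in `A` and degree at least `k`. -/
def degSum (γ γ' β : ℝ) (m : ℕ) (A : Set ℝ) {Ω : Type*} [MeasurableSpace Ω]
    (μ : Measure Ω) (P P' : Ω → Config) (k : ℕ) : ℝ≥0∞ :=
  ∫⁻ ω, ∑' Δ : simplicesIn γ γ' β m A (P ω) (P' ω), degInd γ γ' β k Δ.1 (P' ω) ∂μ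

lemma typicalDegTail_eq {Ω : Type*} [MeasurableSpace Ω] (μ : Measure Ω) (P P' : Ω → Config)
    (k : ℕ) : typicalDegTail γ γ' β m A μ P P' k =
      (simplexIntensity γ γ' β m A μ P P')⁻¹ * degSum γ γ' β m A μ P P' k := by
  simp only [typicalDegTail, typicalExpectation, degSum, degInd, deg_shift]

/-- A simplex has a common neighbour by definition, hence degree at least 1; bounds on `degSum` thus
also control the normalisation. -/
lemma simplexIntensity_eq {Ω : Type*} [MeasurableSpace Ω] (μ : Measure Ω) (P P' : Ω → Config) :
    simplexIntensity γ γ' β m A μ P P' = degSum γ γ' β m A μ P P' 1 := by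
  refine lintegral_congr fun ω => ?_
  rw [← ENNReal.tsum_set_one]
  refine tsum_congr fun Δ => ?_
  rw [degInd, if_pos]
  rw [Nat.cast_one, Order.one_le_iff_ne_zero]
  simpa [deg, Config.count, ← Set.nonempty_iff_ne_empty] using Δ.2.1.2.2

lemma degSum_antitone {Ω : Type*} [MeasurableSpace Ω] (μ : Measure Ω) (P P' : Ω → Config) :
    Antitone (degSum γ γ' β m A μ P P') := by
  intro k l hkl
  refine lintegral_mono fun ω => ENNReal.tsum_le_tsum fun Δ => ?_
  unfold degInd
  have : (k : ℕ∞) ≤ l := by exact_mod_cast hkl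
  split_ifs with h1 h2
  · exact le_rfl
  · exact absurd (this.trans h1) h2
  · exact zero_le_one
  · exact le_rfl

/-- For the upper bound it is enough to remember that the centre is the location of some vertex.
This replaces the condition on the centre by one on a single coordinate. -/
lemma exists_tuple_of_mem_simplicesIn {q q' : Config} {Δ : Finset Pt}
    (h : Δ ∈ simplicesIn γ γ' β m A q q') :
    ∃ t ∈ q.tuples (m + 1), vertices t = Δ ∧ ∃ j, (t j).1 ∈ A := by
  obtain ⟨⟨h1, h2, -⟩, h3⟩ := h
  let e := Δ.equivFinOfCardEq h2
  have hv : vertices (fun i => (e.symm i).1) = Δ := by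
    ext p
    rw [mem_vertices]
    constructor
    · rintro ⟨i, rfl⟩
      exact (e.symm i).2
    · intro hp
      exact ⟨e ⟨p, hp⟩, by simp⟩
  refine ⟨fun i => (e.symm i).1, ⟨Subtype.val_injective.comp e.symm.injective,
    fun i => h1 (e.symm i).2⟩, hv, ?_⟩
  have hne : Δ.Nonempty := Finset.card_pos.mp (by omega)
  obtain ⟨p, hp, hmin⟩ := Δ.exists_min_image (fun p => p.2) hne
  have hfin : {x : ℝ | ∃ u : unitInterval, (x, u) ∈ Δ ∧ ∀ q ∈ Δ, u ≤ q.2}.Finite := by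
    refine (Δ.finite_toSet.image Prod.fst).subset ?_
    rintro x ⟨u, hu, -⟩
    exact ⟨(x, u), hu, rfl⟩
  -- The infimum of a finite nonempty set is attained, so the centre really is the location of a
  -- vertex.
  have hmem : center Δ ∈ {x : ℝ | ∃ u : unitInterval, (x, u) ∈ Δ ∧ ∀ q ∈ Δ, u ≤ q.2} :=
    Set.Nonempty.csInf_mem ⟨p.1, p.2, hp, hmin⟩ hfin
  obtain ⟨u, hu, -⟩ := hmem
  refine ⟨e ⟨_, hu⟩, ?_⟩
  simpa using h3

/-- Choosing one ordering per simplex is injective, since the vertices recover the simplex.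
Overcounting on the right costs only constant factors. -/
lemma tsum_simplicesIn_le (q q' : Config) (g : Finset Pt → ℝ≥0∞) :
    ∑' Δ : simplicesIn γ γ' β m A q q', g Δ.1 ≤
      ∑ j, ∑' t : q.tuples (m + 1), A.indicator 1 (t.1 j).1 * g (vertices t.1) := by
  choose T hT hTv hTA using fun Δ : simplicesIn γ γ' β m A q q' =>
    exists_tuple_of_mem_simplicesIn Δ.2
  let T' : simplicesIn γ γ' β m A q q' → q.tuples (m + 1) := fun Δ => ⟨T Δ, hT Δ⟩
  have hinj : Function.Injective T' := by
    intro Δ Δ' h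
    apply Subtype.ext
    rw [← hTv Δ, ← hTv Δ', show T Δ = T Δ' from congrArg Subtype.val h]
  rw [← Summable.tsum_finsetSum fun _ _ => ENNReal.summable]
  refine le_trans (ENNReal.tsum_le_tsum fun Δ => ?_) (ENNReal.tsum_comp_le_tsum_of_injective hinj
    fun t : q.tuples (m + 1) => ∑ j, A.indicator 1 (t.1 j).1 * g (vertices t.1))
  obtain ⟨j, hj⟩ := hTA Δ
  refine le_trans ?_ (Finset.single_le_sum (fun _ _ => zero_le) (Finset.mem_univ j))
  simp only [T', hTv, Set.indicator_of_mem hj, Pi.one_apply, one_mul]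
  exact le_rfl

lemma center_vertices {t : Fin (m + 1) → Pt} (h : ∀ i, i ≠ 0 → (t 0).2 < (t i).2) :
    center (vertices t) = (t 0).1 := by
  have : {x : ℝ | ∃ u : unitInterval, (x, u) ∈ vertices t ∧ ∀ q ∈ vertices t, u ≤ q.2} =
      {(t 0).1} := by
    ext x
    simp only [Set.mem_ofPred_eq, Set.mem_singleton_iff]
    constructor
    · rintro ⟨u, hu, hmin⟩
      obtain ⟨i, hi⟩ := mem_vertices.mp hu
      have h0 := hmin (t 0) (mem_vertices.mpr ⟨0, rfl⟩)
      by_cases hi0 : i = 0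
      · rw [← hi0, hi]
      · have := h i hi0
        rw [hi] at this
        exact absurd this (not_lt.mpr h0)
    · rintro rfl
      refine ⟨(t 0).2, mem_vertices.mpr ⟨0, rfl⟩, fun q hq => ?_⟩
      obtain ⟨i, rfl⟩ := mem_vertices.mp hq
      by_cases hi0 : i = 0
      · rw [hi0]
      · exact (h i hi0).le
  rw [center, this, csInf_singleton]

/-- A product of disjoint sets of points whose tuples all form simplices with centre in `A` gives
a lower bound for the number of simplices. -/
lemma tuples_pi_le_tsum {q q' : Config} {B : Fin (m + 1) → Set Pt} {S : Set Pt} {k : ℕ}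
    (hk : 0 < k) (hB : ∀ i, MeasurableSet (B i)) (hd : Pairwise fun i j => Disjoint (B i) (B j))
    (hA : ∀ p ∈ B 0, p.1 ∈ A) (hlt : ∀ i, i ≠ 0 → ∀ p ∈ B 0, ∀ p' ∈ B i, p.2 < p'.2)
    (hS : ∀ i, ∀ p ∈ B i, ∀ p' ∈ S, F γ γ' p p' ≤ β) (hq' : (k : ℕ∞) ≤ q'.count S) :
    tupleKernel (m + 1) q (Set.univ.pi B) ≤
      ∑' Δ : simplicesIn γ γ' β m A q q', degInd γ γ' β k Δ.1 q' := by
  rw [tupleKernel_apply, diracSum_apply _ (MeasurableSet.univ_pi hB), ← ENNReal.tsum_set_one]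
  have hnb : ∀ t ∈ Set.univ.pi B, S ⊆ nbhd γ γ' β (vertices t) := by
    intro t ht p' hp' p hp
    obtain ⟨i, rfl⟩ := mem_vertices.mp hp
    exact hS i _ (ht i trivial) p' hp'
  have hdeg : ∀ t ∈ Set.univ.pi B, (k : ℕ∞) ≤ deg γ γ' β (vertices t) q' := fun t ht =>
    hq'.trans (Set.encard_le_encard (Set.inter_subset_inter_right _ (hnb t ht)))
  have hmem : ∀ t ∈ q.tuples (m + 1) ∩ Set.univ.pi B,
      vertices t ∈ simplicesIn γ γ' β m A q q' := by
    rintro t ⟨ht, htB⟩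
    refine ⟨⟨?_, ?_, ?_⟩, ?_⟩
    · intro p hp
      obtain ⟨i, rfl⟩ := mem_vertices.mp hp
      exact ht.2 i
    · rw [vertices, Finset.card_image_of_injective _ ht.1, Finset.card_univ, Fintype.card_fin]
    · rw [← Set.encard_pos]
      exact lt_of_lt_of_le (by exact_mod_cast hk) (hdeg t htB)
    · rw [center_vertices fun i hi => hlt i hi _ (htB 0 trivial) _ (htB i trivial)]
      exact hA _ (htB 0 trivial)
  let T : ↥(q.tuples (m + 1) ∩ Set.univ.pi B) → simplicesIn γ γ' β m A q q' :=
    fun t => ⟨vertices t.1, hmem t.1 t.2⟩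
  have hinj : Function.Injective T := by
    rintro ⟨t, ht, htB⟩ ⟨s, hs, hsB⟩ h
    have hv : vertices t = vertices s := congrArg Subtype.val h
    apply Subtype.ext
    funext i
    have : t i ∈ vertices s := hv ▸ mem_vertices.mpr ⟨i, rfl⟩
    obtain ⟨j, hj⟩ := mem_vertices.mp this
    -- Disjointness of the B i fixes the ordering of the vertices, so distinct tuples give distinct
    -- simplices.
    by_cases hij : j = i
    · subst hij
      exact hj.symm
    · exact (Set.disjoint_left.mp (hd hij) (hsB j trivial) (hj ▸ htB i trivial)).elim
  refine le_trans (ENNReal.tsum_le_tsum fun t => ?_) (ENNReal.tsum_comp_le_tsum_of_injective hinj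
    fun Δ => degInd γ γ' β k Δ.1 q')
  rw [degInd, if_pos (hdeg t.1 t.2.2)]

end Simplices

/-! ### Upper bounds -/

section Upper

variable {γ γ' β : ℝ} {m : ℕ} {A : Set ℝ} {Ω : Type*} [MeasurableSpace Ω] {μ : Measure Ω}
  [IsProbabilityMeasure μ] {P P' : Ω → Config} {r r' : ℝ≥0}

lemma pi_smul_volume (r : ℝ≥0) (n : ℕ) :
    (Measure.pi fun _ : Fin n => r • (volume : Measure Pt)) =
      (r : ℝ≥0∞) ^ n • Measure.pi fun _ : Fin n => (volume : Measure Pt) := by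
  apply Measure.pi_eq
  intro s hs
  rw [Measure.smul_apply, Measure.pi_pi, smul_eq_mul]
  simp only [Measure.smul_apply, ENNReal.smul_def, smul_eq_mul, Finset.prod_mul_distrib,
    Finset.prod_const, Finset.card_univ, Fintype.card_fin]

/-- A one-sided multivariate Campbell formula: by independence the configuration q' is frozen, and
the sum over tuples is then bounded through the factorial moment measure. -/
lemma lintegral_tupleKernel_le (hP : IsPoissonProcess μ P r) (hP' : Measurable P')
    (hindep : IndepFun P P' μ) {n : ℕ} {Φ : (Fin n → Pt) × Config → ℝ≥0∞} (hΦ : Measurable Φ) :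
    ∫⁻ ω, ∫⁻ t, Φ (t, P' ω) ∂(tupleKernel n (P ω)) ∂μ ≤
      r ^ n * ∫⁻ t, (∫⁻ ω, Φ (t, P' ω) ∂μ) ∂(Measure.pi fun _ => (volume : Measure Pt)) := by
  have : IsProbabilityMeasure (μ.map P) := Measure.isProbabilityMeasure_map hP.measurable.aemeasurable
  have : IsProbabilityMeasure (μ.map P') := Measure.isProbabilityMeasure_map hP'.aemeasurable
  have : SigmaFinite (Measure.pi fun _ : Fin n => (volume : Measure Pt)) :=
    Measure.pi.sigmaFinite _
  have hmap := (indepFun_iff_map_prod_eq_prod_map_map hP.measurable.aemeasurable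
    hP'.aemeasurable).mp hindep
  have hΦq : ∀ q', Measurable fun t => Φ (t, q') := fun q' => hΦ.comp measurable_prodMk_right
  have hΦt : ∀ t, Measurable fun q' => Φ (t, q') := fun t => hΦ.comp measurable_prodMk_left
  have hΦs : Measurable fun x : Config × (Fin n → Pt) => Φ (x.2, x.1) := hΦ.comp measurable_swap
  have hm : Measurable fun x : Config × Config => ∫⁻ t, Φ (t, x.2) ∂(tupleKernel n x.1) := by
    have := Measurable.lintegral_kernel_prod_right
      (κ := (tupleKernel n).comap (Prod.fst : Config × Config → Config) measurable_fst)
      (f := fun x t => Φ (t, x.2)) (hΦ.comp (by fun_prop))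
    simpa using this
  calc ∫⁻ ω, ∫⁻ t, Φ (t, P' ω) ∂(tupleKernel n (P ω)) ∂μ
      = ∫⁻ x, (∫⁻ t, Φ (t, x.2) ∂(tupleKernel n x.1)) ∂(μ.map fun ω => (P ω, P' ω)) := by
        rw [lintegral_map hm (hP.measurable.prodMk hP')]
    _ = ∫⁻ q', ∫⁻ q, (∫⁻ t, Φ (t, q') ∂(tupleKernel n q)) ∂(μ.map P) ∂(μ.map P') := by
        rw [hmap, lintegral_prod_symm' _ hm]
    _ = ∫⁻ q', (∫⁻ t, Φ (t, q') ∂((μ.map P).bind (tupleKernel n))) ∂(μ.map P') := by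
        refine lintegral_congr fun q' => ?_
        rw [Measure.lintegral_bind (tupleKernel n).measurable.aemeasurable
          (hΦq q').aemeasurable]
    _ ≤ ∫⁻ q', (∫⁻ t, Φ (t, q') ∂((r : ℝ≥0∞) ^ n •
          Measure.pi fun _ : Fin n => (volume : Measure Pt))) ∂(μ.map P') := by
        refine lintegral_mono fun q' => ?_
        rw [← pi_smul_volume]
        exact lintegral_mono' (hP.bind_tupleKernel_le n) le_rfl
    _ = r ^ n * ∫⁻ q', (∫⁻ t, Φ (t, q') ∂(Measure.pi fun _ => (volume : Measure Pt)))
          ∂(μ.map P') := by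
        simp_rw [lintegral_smul_measure, smul_eq_mul]
        rw [lintegral_const_mul]
        exact hΦs.lintegral_prod_right'
    _ = r ^ n * ∫⁻ t, (∫⁻ q', Φ (t, q') ∂(μ.map P'))
          ∂(Measure.pi fun _ => (volume : Measure Pt)) := by
        rw [lintegral_lintegral_swap (f := fun q' t => Φ (t, q')) hΦs.aemeasurable]
    _ = _ := by
        congr 1
        refine lintegral_congr fun t => ?_
        rw [lintegral_map (hΦt t) hP']

/-- The degree is the mass that the counting kernel gives to a section of a measurable set, hence
jointly measurable in tuple and configuration. -/
lemma measurable_degInd (γ γ' β : ℝ) (k n : ℕ) :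
    Measurable fun x : (Fin n → Pt) × Config => degInd γ γ' β k (vertices x.1) x.2 := by
  have hset : MeasurableSet {y : ((Fin n → Pt) × Config) × Pt |
      y.2 ∈ nbhd γ γ' β (vertices y.1.1)} := by
    have : {y : ((Fin n → Pt) × Config) × Pt | y.2 ∈ nbhd γ γ' β (vertices y.1.1)} =
        ⋂ i, (fun y : ((Fin n → Pt) × Config) × Pt => (y.1.1 i, y.2)) ⁻¹' connected γ γ' β := by
      ext y
      simp [nbhd, vertices, connected]
    rw [this]
    exact MeasurableSet.iInter fun i =>
      measurableSet_preimage (by fun_prop) (measurableSet_connected γ γ' β)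
  have h1 := Kernel.measurable_kernel_prodMk_left
    (κ := countKernel.comap (Prod.snd : (Fin n → Pt) × Config → Config) measurable_snd) hset
  have h2 : Measurable fun x : (Fin n → Pt) × Config =>
      (deg γ γ' β (vertices x.1) x.2 : ℝ≥0∞) := by
    convert! h1 using 2 with x
    rw [Kernel.comap_apply]
    exact (countKernel_apply x.2 (measurableSet_nbhd γ γ' β (vertices x.1))).symm
  have h3 : MeasurableSet {x : (Fin n → Pt) × Config |
      (k : ℕ∞) ≤ deg γ γ' β (vertices x.1) x.2} := by
    have : {x : (Fin n → Pt) × Config | (k : ℕ∞) ≤ deg γ γ' β (vertices x.1) x.2} =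
        {x | (k : ℝ≥0∞) ≤ (deg γ γ' β (vertices x.1) x.2 : ℝ≥0∞)} := by
      ext x
      simp only [Set.mem_ofPred_eq]
      rw [← ENat.toENNReal_coe, ENat.toENNReal_le]
    rw [this]
    exact measurableSet_le measurable_const h2
  unfold degInd
  exact Measurable.ite h3 measurable_const measurable_const

/-- Any tail bound of the form c V ∏ G(mark) integrates explicitly. With G = 1 it yields a finite
intensity, and with the truncated powers of `measure_le_count_nbhd_le` it yields the decay in k. -/
theorem degSum_le (hβ : 0 < β) (hP : IsPoissonProcess μ P r) (hP' : IsPoissonProcess μ P' r')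
    (hindep : IndepFun P P' μ) (hA : MeasurableSet A) {k : ℕ} {G : unitInterval → ℝ≥0∞}
    (hG : Measurable G) {c : ℝ≥0∞} (hc : c ≠ ∞)
    (h : ∀ t : Fin (m + 1) → Pt, μ {ω | (k : ℕ∞) ≤ (P' ω).count (nbhd γ γ' β (vertices t))} ≤
      c * (volume (nbhd γ γ' β (vertices t)) * ∏ i, G (t i).2)) :
    degSum γ γ' β m A μ P P' k ≤ (m + 1) * (r ^ (m + 1) * (c *
      ((ENNReal.ofReal (2 * β) * ∫⁻ u, weight γ u * G u) ^ (m + 1) * volume A *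
        ∫⁻ w, weight γ' w ^ (m + 1)))) := by
  set Q := r ^ (m + 1) * (c *
      ((ENNReal.ofReal (2 * β) * ∫⁻ u, weight γ u * G u) ^ (m + 1) * volume A *
        ∫⁻ w, weight γ' w ^ (m + 1))) with hQ
  let Φ : Fin (m + 1) → (Fin (m + 1) → Pt) × Config → ℝ≥0∞ := fun j x =>
    A.indicator 1 (x.1 j).1 * degInd γ γ' β k (vertices x.1) x.2
  have hAj : ∀ j, Measurable fun t : Fin (m + 1) → Pt => A.indicator (1 : ℝ → ℝ≥0∞) (t j).1 :=
    fun j => (measurable_one.indicator hA).comp (by fun_prop)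
  have hΦ : ∀ j, Measurable (Φ j) := fun j =>
    ((hAj j).comp measurable_fst).mul (measurable_degInd γ γ' β k (m + 1))
  have hmt : ∀ j, Measurable fun ω => ∫⁻ t, Φ j (t, P' ω) ∂(tupleKernel (m + 1) (P ω)) := by
    intro j
    have := Measurable.lintegral_kernel_prod_right
      (κ := (tupleKernel (m + 1)).comap P hP.measurable)
      (f := fun ω t => Φ j (t, P' ω))
      ((hΦ j).comp (measurable_snd.prodMk (hP'.measurable.comp measurable_fst)))
    simpa using this
  calc degSum γ γ' β m A μ P P' k
      ≤ ∫⁻ ω, ∑ j, ∫⁻ t, Φ j (t, P' ω) ∂(tupleKernel (m + 1) (P ω)) ∂μ := by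
        refine lintegral_mono fun ω => ?_
        refine (tsum_simplicesIn_le (P ω) (P' ω) fun Δ => degInd γ γ' β k Δ (P' ω)).trans_eq ?_
        refine Finset.sum_congr rfl fun j _ => ?_
        have hj : Measurable fun t => Φ j (t, P' ω) := (hΦ j).comp measurable_prodMk_right
        rw [tupleKernel_apply, lintegral_diracSum _ hj]
    _ = ∑ j, ∫⁻ ω, ∫⁻ t, Φ j (t, P' ω) ∂(tupleKernel (m + 1) (P ω)) ∂μ :=
        lintegral_finsetSum _ fun j _ => hmt j
    _ ≤ ∑ _j : Fin (m + 1), Q := by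
        refine Finset.sum_le_sum fun j _ => ?_
        refine (lintegral_tupleKernel_le hP hP'.measurable hindep (hΦ j)).trans ?_
        rw [hQ]
        gcongr
        refine le_trans ?_ (mul_le_mul_right
          (lintegral_volume_nbhd_le (γ := γ) (γ' := γ') hβ hG hA j) c)
        rw [← lintegral_const_mul' _ _ hc]
        refine lintegral_mono fun t => ?_
        have hd : Measurable fun ω => degInd γ γ' β k (vertices t) (P' ω) :=
          ((measurable_degInd γ γ' β k (m + 1)).comp measurable_prodMk_left).comp hP'.measurable
        have e1 : ∫⁻ ω, degInd γ γ' β k (vertices t) (P' ω) ∂μ =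
            μ {ω | (k : ℕ∞) ≤ (P' ω).count (nbhd γ γ' β (vertices t))} := by
          have hms : MeasurableSet
              {ω | (k : ℕ∞) ≤ (P' ω).count (nbhd γ γ' β (vertices t))} :=
            (hP'.measurable_count (measurableSet_nbhd γ γ' β _))
              (MeasurableSet.of_discrete (s := Set.Ici (k : ℕ∞)))
          rw [← lintegral_indicator_one hms]
          refine lintegral_congr fun ω => ?_
          by_cases hω : (k : ℕ∞) ≤ (P' ω).count (nbhd γ γ' β (vertices t))
          · simp [degInd, deg, hω]
          · simp [degInd, deg, hω]
        simp only [Φ]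
        rw [lintegral_const_mul _ hd, e1]
        refine (mul_le_mul_right (h t) _).trans_eq ?_
        ring
    _ = (m + 1) * Q := by simp

theorem simplexIntensity_ne_top (hγ1 : γ < 1) (hγ' : γ' < 1 / ((m : ℝ) + 1)) (hβ : 0 < β)
    (hr' : r' ≠ 0) (hP : IsPoissonProcess μ P r) (hP' : IsPoissonProcess μ P' r')
    (hindep : IndepFun P P' μ) (hA : MeasurableSet A) (hA1 : volume A ≠ ∞) :
    simplexIntensity γ γ' β m A μ P P' ≠ ∞ := by
  rw [simplexIntensity_eq]
  refine ne_top_of_le_ne_top ?_ (degSum_le (G := fun _ => 1) (c := r') hβ hP hP' hindep hA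
    measurable_const (by simp) fun t => ?_)
  · have h1 : ∫⁻ u, weight γ u * 1 ≠ ∞ := by
      simpa using lintegral_weight_pow_ne_top (γ := γ) (n := 1) (by simpa using hγ1)
    have h2 : ∫⁻ w, weight γ' w ^ (m + 1) ≠ ∞ := by
      refine lintegral_weight_pow_ne_top ?_
      rw [lt_div_iff₀ (by positivity)] at hγ'
      exact_mod_cast hγ'
    finiteness
  · refine (hP'.measure_le_count_le hr' (measurableSet_nbhd γ γ' β _) one_ne_zero
      le_rfl).trans_eq ?_
    simp [Nat.descFactorial_one]

lemma half_pow_le_descFactorial {N k : ℕ} (h : 2 * N ≤ k) :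
    ((k : ℝ≥0∞) / 2) ^ N ≤ (k.descFactorial N : ℝ≥0∞) := by
  have h1 : ((k + 1 - N) ^ N : ℕ) ≤ k.descFactorial N := Nat.pow_sub_le_descFactorial k N
  refine le_trans ?_ (Nat.cast_le.mpr h1)
  push_cast
  gcongr
  refine ENNReal.div_le_of_le_mul ?_
  have : k ≤ (k + 1 - N) * 2 := by omega
  exact_mod_cast this

/-- With x = r'V/k, the factorial moments of orders 1 and N bound the tail by both x and 2^N x^N,
hence by 2^N x min(1, x)^(N-1). As N - 1 = (m+1)M, each vertex receives M factors, in which V is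
bounded through that vertex's own mark. The remaining factor x keeps V for the integration over
common neighbours. -/
lemma measure_le_count_nbhd_le (hβ : 0 < β) (hr' : r' ≠ 0) (hP' : IsPoissonProcess μ P' r')
    (M : ℕ) {D : ℝ≥0}
    (hD : (r' : ℝ≥0∞) * (ENNReal.ofReal (2 * β) * ∫⁻ w, weight γ' w) ≤ D) {k : ℕ}
    (hk : 2 * ((m + 1) * M + 1) ≤ k) (t : Fin (m + 1) → Pt) :
    μ {ω | (k : ℕ∞) ≤ (P' ω).count (nbhd γ γ' β (vertices t))} ≤
      2 ^ ((m + 1) * M + 1) * r' / k * (volume (nbhd γ γ' β (vertices t)) *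
        ∏ i, (min 1 (D * weight γ (t i).2 / k)) ^ M) := by
  set V := volume (nbhd γ γ' β (vertices t)) with hV
  set N := (m + 1) * M + 1 with hN
  set x := (r' : ℝ≥0∞) * V / k with hx
  have hm := measurableSet_nbhd γ γ' β (vertices t)
  have h1 : μ {ω | (k : ℕ∞) ≤ (P' ω).count (nbhd γ γ' β (vertices t))} ≤ x := by
    simpa [Nat.descFactorial_one] using
      hP'.measure_le_count_le hr' hm one_ne_zero (by omega : 1 ≤ k)
  have h2 : μ {ω | (k : ℕ∞) ≤ (P' ω).count (nbhd γ γ' β (vertices t))} ≤ 2 ^ N * x ^ N := by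
    refine (hP'.measure_le_count_le hr' hm (by omega : N ≠ 0) (by omega : N ≤ k)).trans ?_
    refine (ENNReal.div_le_div_left (half_pow_le_descFactorial hk) _).trans_eq ?_
    rw [← hV, hx, ← mul_pow, ENNReal.div_eq_inv_mul, ENNReal.inv_pow, ← mul_pow,
      ENNReal.inv_div (by simp) (by simp)]
    congr 1
    rw [div_eq_mul_inv, div_eq_mul_inv]
    ring
  have h3 : μ {ω | (k : ℕ∞) ≤ (P' ω).count (nbhd γ γ' β (vertices t))} ≤
      2 ^ N * (x * min 1 x ^ ((m + 1) * M)) := by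
    rcases le_total x 1 with hx1 | hx1
    · rw [min_eq_right hx1, ← pow_succ']
      exact h2
    · rw [min_eq_left hx1, one_pow, mul_one]
      exact h1.trans (le_mul_of_one_le_left' (one_le_pow_of_one_le' one_le_two _))
  have h4 : min 1 x ^ ((m + 1) * M) ≤ ∏ i, (min 1 (D * weight γ (t i).2 / k)) ^ M := by
    have : min 1 x ^ ((m + 1) * M) = ∏ _i : Fin (m + 1), min 1 x ^ M := by
      rw [Finset.prod_const, Finset.card_univ, Fintype.card_fin, ← pow_mul, mul_comm M]
    rw [this]
    refine Finset.prod_le_prod' fun i _ => ?_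
    gcongr
    rw [hx]
    refine ENNReal.div_le_div_right ?_ _
    refine (mul_le_mul_right (volume_nbhd_le hβ (mem_vertices.mpr ⟨i, rfl⟩)) _).trans ?_
    rw [← mul_assoc]
    gcongr
  refine h3.trans ((mul_le_mul_right (mul_le_mul_right h4 _) _).trans_eq ?_)
  rw [hx, div_eq_mul_inv, div_eq_mul_inv]
  ring

theorem exists_degSum_le (hγ0 : 0 < γ) (hγ1 : γ < 1) (hγ'0 : 0 < γ')
    (hγ' : γ' < 1 / ((m : ℝ) + 1)) (hβ : 0 < β)
    (hr' : r' ≠ 0) (hP : IsPoissonProcess μ P r) (hP' : IsPoissonProcess μ P' r')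
    (hindep : IndepFun P P' μ) (hA : MeasurableSet A) (hA1 : volume A ≠ ∞) :
    ∃ C : ℝ, ∀ᶠ k : ℕ in atTop, degSum γ γ' β m A μ P P' k ≤
      ENNReal.ofReal (C * (k : ℝ) ^ ((m : ℝ) - (m + 1) / γ)) := by
  -- M is chosen so that γ(M+1) > 1, which makes the contribution of large marks converge.
  obtain ⟨M, hM⟩ := exists_nat_gt (1 / γ)
  have hM' : 1 < γ * (M + 1) := by
    rw [div_lt_iff₀ hγ0] at hM
    nlinarith
  have hγ'm : γ' * ((m : ℝ) + 1) < 1 := by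
    rwa [lt_div_iff₀ (by positivity)] at hγ'
  have hγ'1 : γ' < 1 := by nlinarith [(Nat.cast_nonneg m : (0 : ℝ) ≤ m)]
  have hW1 : ∫⁻ w, weight γ' w ≠ ∞ := by
    simpa using lintegral_weight_pow_ne_top (γ := γ') (n := 1) (by simpa using hγ'1)
  have hW : ∫⁻ w, weight γ' w ^ (m + 1) ≠ ∞ :=
    lintegral_weight_pow_ne_top (by exact_mod_cast hγ'm)
  obtain ⟨D, hD⟩ : ∃ D : ℝ≥0, (D : ℝ≥0∞) =
      (r' : ℝ≥0∞) * (ENNReal.ofReal (2 * β) * ∫⁻ w, weight γ' w) :=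
    ⟨_, ENNReal.coe_toNNReal (by finiteness)⟩
  obtain ⟨C, hC0, hC⟩ := lintegral_weight_mul_min_pow_le hγ0 hγ1 D hM'
  set K : ℝ≥0∞ := (m + 1) * (r ^ (m + 1) * (2 ^ ((m + 1) * M + 1) * r' *
    (ENNReal.ofReal (2 * β) ^ (m + 1) * volume A * ∫⁻ w, weight γ' w ^ (m + 1)))) with hK
  have hKt : K ≠ ∞ := by finiteness
  refine ⟨K.toReal * C ^ (m + 1), ?_⟩
  filter_upwards [eventually_ge_atTop (2 * ((m + 1) * M + 1))] with k hk
  have hk0 : 0 < k := by omega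
  have hk' : (0 : ℝ) < k := by exact_mod_cast hk0
  have hkE : (k : ℝ≥0∞) ≠ 0 := by exact_mod_cast hk0.ne'
  have hG : Measurable fun u => (min 1 (D * weight γ u / k)) ^ M :=
    (measurable_const.min (((measurable_weight γ).const_mul _).div_const _)).pow_const _
  refine (degSum_le hβ hP hP' hindep hA hG (by finiteness)
    (measure_le_count_nbhd_le hβ hr' hP' M hD.ge hk)).trans ?_
  calc _ ≤ (m + 1) * (r ^ (m + 1) * (2 ^ ((m + 1) * M + 1) * r' / k *
        ((ENNReal.ofReal (2 * β) * ENNReal.ofReal (C * (k : ℝ) ^ (1 - 1 / γ))) ^ (m + 1) *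
          volume A * ∫⁻ w, weight γ' w ^ (m + 1)))) := by
        gcongr
        exact hC k hk0
    _ = K * ((k : ℝ≥0∞)⁻¹ * ENNReal.ofReal (C * (k : ℝ) ^ (1 - 1 / γ)) ^ (m + 1)) := by
        rw [hK, div_eq_mul_inv]
        ring
    _ = ENNReal.ofReal (K.toReal * C ^ (m + 1) * (k : ℝ) ^ ((m : ℝ) - (m + 1) / γ)) := by
        rw [← ENNReal.ofReal_toReal hKt, ← ENNReal.ofReal_natCast,
          ← ENNReal.ofReal_inv_of_pos hk', ← ENNReal.ofReal_pow (by positivity),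
          ← ENNReal.ofReal_mul (by positivity), ← ENNReal.ofReal_mul (by positivity),
          ENNReal.toReal_ofReal (by positivity)]
        congr 1
        -- The exponent count: -1 + (m+1)(1 - 1/γ) = m - (m+1)/γ.
        have e : (k : ℝ) ^ ((m : ℝ) - (m + 1) / γ) =
            (k : ℝ)⁻¹ * ((k : ℝ) ^ (1 - 1 / γ)) ^ (m + 1) := by
          rw [← Real.rpow_natCast, ← Real.rpow_mul hk'.le, ← Real.rpow_neg_one,
            ← Real.rpow_add hk']
          congr 1
          push_cast
          field_simp
          ring
        rw [e, mul_pow]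
        ring

end Upper

/-! ### The lower bound -/

/-- The marks in `(a, b]`. -/
def markSlab (a b : ℝ) : Set unitInterval := {u | (u : ℝ) ∈ Set.Ioc a b}

lemma measurableSet_markSlab (a b : ℝ) : MeasurableSet (markSlab a b) :=
  measurable_subtype_coe measurableSet_Ioc

lemma volume_markSlab {a b : ℝ} (ha : 0 ≤ a) (hb : b ≤ 1) :
    volume (markSlab a b) = ENNReal.ofReal (b - a) := by
  rw [unitInterval.volume_apply]
  have : Subtype.val '' markSlab a b = Set.Ioc a b := by
    ext x
    constructor
    · rintro ⟨u, hu, rfl⟩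
      exact hu
    · intro hx
      exact ⟨⟨x, ha.trans hx.1.le, hx.2.trans hb⟩, hx, rfl⟩
  rw [this, Real.volume_Ioc]

/-- Locations in the window differ by at most 2X and w^γ' ≤ 1, so u^γ ≤ β/(2X) suffices whatever the
mark of p'. -/
lemma F_le {γ γ' β X : ℝ} (hγ0 : 0 < γ) (hγ'0 : 0 < γ') (hβ : 0 < β) (hX : 0 < X) {p p' : Pt}
    (hp : p.1 ∈ Set.Icc (-X) X) (hp' : p'.1 ∈ Set.Icc (-X) X)
    (hu : (p.2 : ℝ) ≤ (β / (2 * X)) ^ (1 / γ)) : F γ γ' p p' ≤ β := by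
  have h1 : |p.1 - p'.1| ≤ 2 * X := by
    rw [abs_le]
    constructor <;> linarith [hp.1, hp.2, hp'.1, hp'.2]
  have h2 : (p.2 : ℝ) ^ γ ≤ β / (2 * X) := by
    refine (Real.rpow_le_rpow p.2.2.1 hu hγ0.le).trans_eq ?_
    rw [← Real.rpow_mul (by positivity), one_div, inv_mul_cancel₀ hγ0.ne', Real.rpow_one]
  have h3 : (p'.2 : ℝ) ^ γ' ≤ 1 := Real.rpow_le_one p'.2.2.1 p'.2.2.2 hγ'0.le
  have h4 : 0 ≤ (p.2 : ℝ) ^ γ := Real.rpow_nonneg p.2.2.1 _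
  have h5 : 0 ≤ (p'.2 : ℝ) ^ γ' := Real.rpow_nonneg p'.2.2.1 _
  calc F γ γ' p p' ≤ (2 * X) * (β / (2 * X)) * 1 := by
        unfold F
        gcongr
    _ = β := by field_simp

/-- A may be unbounded, whereas the lower bound needs centres inside the window. -/
lemma exists_bounded_part {A : Set ℝ} (hA : volume A ≠ 0) :
    ∃ n : ℕ, volume (A ∩ Set.Icc (-(n : ℝ)) n) ≠ 0 := by
  by_contra! h
  apply hA
  refine measure_mono_null ?_ (measure_iUnion_null h)
  intro x hx
  obtain ⟨n, hn⟩ := exists_nat_ge |x|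
  exact Set.mem_iUnion.mpr ⟨n, hx, abs_le.mp hn⟩

section Lower

variable {γ γ' β : ℝ} {m : ℕ} {A : Set ℝ} {Ω : Type*} [MeasurableSpace Ω] {μ : Measure Ω}
  {P P' : Ω → Config} {r r' : ℝ≥0}

/-- If all tuples in a product of disjoint sets form simplices whose common neighbourhood
contains `S`, the mean number of simplices of high degree is bounded below. -/
lemma mul_prod_le_degSum (hP : IsPoissonProcess μ P r) (hP' : IsPoissonProcess μ P' r')
    (hindep : IndepFun P P' μ) {B : Fin (m + 1) → Set Pt} {S : Set Pt} {k : ℕ}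
    (hk : 0 < k) (hB : ∀ i, MeasurableSet (B i)) (hd : Pairwise fun i j => Disjoint (B i) (B j))
    (hfin : ∀ i, volume (B i) ≠ ∞)
    (hA : ∀ p ∈ B 0, p.1 ∈ A) (hlt : ∀ i, i ≠ 0 → ∀ p ∈ B 0, ∀ p' ∈ B i, p.2 < p'.2)
    (hSm : MeasurableSet S) (hS : ∀ i, ∀ p ∈ B i, ∀ p' ∈ S, F γ γ' p p' ≤ β) :
    μ {ω | (k : ℕ∞) ≤ (P' ω).count S} * ∏ i, (r * volume (B i)) ≤
      degSum γ γ' β m A μ P P' k := by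
  have hE : MeasurableSet {q' : Config | (k : ℕ∞) ≤ q'.count S} :=
    (measurable_count hSm) (MeasurableSet.of_discrete (s := Set.Ici (k : ℕ∞)))
  let f : Config → ℝ≥0∞ := {q' : Config | (k : ℕ∞) ≤ q'.count S}.indicator 1
  let g : Config → ℝ≥0∞ := fun q => tupleKernel (m + 1) q (Set.univ.pi B)
  have hf : Measurable f := measurable_one.indicator hE
  have hg : Measurable g := (tupleKernel (m + 1)).measurable_coe (MeasurableSet.univ_pi hB)
  -- The event that S is well filled depends on P' alone and the number of tuples on P alone, so the
  -- expectation factorises.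
  have h1 : ∫⁻ ω, f (P' ω) * g (P ω) ∂μ =
      (∫⁻ ω, f (P' ω) ∂μ) * ∫⁻ ω, g (P ω) ∂μ :=
    lintegral_mul_eq_lintegral_mul_lintegral_of_indepFun (hf.comp hP'.measurable)
      (hg.comp hP.measurable) (hindep.symm.comp hf hg)
  have h2 : ∫⁻ ω, f (P' ω) ∂μ = μ {ω | (k : ℕ∞) ≤ (P' ω).count S} := by
    exact lintegral_indicator_one (hP'.measurable hE)
  rw [← h2, ← hP.lintegral_tuples_pi hB hd hfin, ← h1]
  refine lintegral_mono fun ω => ?_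
  by_cases hω : (k : ℕ∞) ≤ (P' ω).count S
  · simp only [f, g]
    rw [Set.indicator_of_mem (s := {q' : Config | (k : ℕ∞) ≤ q'.count S}) hω, Pi.one_apply,
      one_mul]
    exact tuples_pi_le_tsum hk hB hd hA hlt hS hω
  · simp only [f, g]
    rw [Set.indicator_of_notMem (s := {q' : Config | (k : ℕ∞) ≤ q'.count S}) hω, zero_mul]
    exact zero_le

/-- One vertex is placed over a bounded part of A and m over the window [-X, X] with X of order k,
all with marks at most b = (β/(2X))^(1/γ). By `F_le` each such tuple is joined to the whole window.
-/
theorem exists_le_degSum (hγ0 : 0 < γ) (hγ'0 : 0 < γ') (hβ : 0 < β) (hr : r ≠ 0) (hr' : r' ≠ 0)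
    (hP : IsPoissonProcess μ P r) (hP' : IsPoissonProcess μ P' r')
    (hindep : IndepFun P P' μ) (hA : MeasurableSet A) (hA1 : volume A ≠ 0) :
    ∃ c : ℝ, 0 < c ∧ ∀ᶠ k : ℕ in atTop,
      ENNReal.ofReal (c * (k : ℝ) ^ ((m : ℝ) - (m + 1) / γ)) ≤ degSum γ γ' β m A μ P P' k := by
  obtain ⟨n, hn⟩ := exists_bounded_part hA1
  set A' := A ∩ Set.Icc (-(n : ℝ)) n with hA'
  have hA'm : MeasurableSet A' := hA.inter measurableSet_Icc
  have hA't : volume A' ≠ ∞ :=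
    ne_top_of_le_ne_top (by simp) (measure_mono (Set.inter_subset_right (s := A)))
  have hr0 : (0 : ℝ) < r := by exact_mod_cast pos_iff_ne_zero.mpr hr
  have hr'0 : (0 : ℝ) < r' := by exact_mod_cast pos_iff_ne_zero.mpr hr'
  have ha0 : 0 < (volume A').toReal := ENNReal.toReal_pos hn hA't
  set a := (volume A').toReal with ha
  -- With X = Lk the mean number of points of P' in the window is 2Xr' = 4k, at least the 2k + 2
  -- required for probability 1/2.
  set L : ℝ := 2 / r' with hL
  have hL0 : 0 < L := by positivity
  set d : ℝ := (β / (2 * L)) ^ (1 / γ) / (m + 1) with hd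
  have hd0 : 0 < d := by positivity
  refine ⟨1 / 2 * ((r * (a * d)) * (r * (2 * L * d)) ^ m), by positivity, ?_⟩
  -- The last two conditions give n ≤ X, so that A' lies in the window, and β/(2X) ≤ 1, so that b ≤
  -- 1.
  filter_upwards [eventually_ge_atTop 1, eventually_ge_atTop ⌈(n : ℝ) / L⌉₊,
    eventually_ge_atTop ⌈β / (2 * L)⌉₊] with k hk1 hkn hkβ
  have hk : (0 : ℝ) < k := by exact_mod_cast hk1
  have hk1' : (1 : ℝ) ≤ k := by exact_mod_cast hk1
  set X : ℝ := L * k with hX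
  have hX0 : 0 < X := by positivity
  have hnX : (n : ℝ) ≤ X := by
    have := (Nat.ceil_le.mp hkn)
    rw [div_le_iff₀ hL0] at this
    linarith
  set b : ℝ := (β / (2 * X)) ^ (1 / γ) with hb
  have hb0 : 0 < b := by positivity
  have hb1 : b ≤ 1 := by
    refine Real.rpow_le_one (by positivity) ?_ (by positivity)
    have := (Nat.ceil_le.mp hkβ)
    rw [div_le_iff₀ (by positivity)] at this
    rw [div_le_one (by positivity)]
    linarith
  -- The marks (0, b] are cut into m + 1 equal slabs, one per vertex. This makes the boxes disjoint
  -- and gives vertex 0 the strictly smallest mark, so that it is the centre.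
  set e : ℝ := b / (m + 1) with he
  have he0 : 0 < e := by positivity
  have heb : e * (m + 1) = b := by rw [he]; field_simp
  have hde : e = d * (k : ℝ) ^ (-(1 / γ)) := by
    rw [he, hd, hb, hX, show β / (2 * (L * k)) = (β / (2 * L)) * (k : ℝ)⁻¹ by field_simp,
      Real.mul_rpow (by positivity) (by positivity), Real.inv_rpow hk.le, ← Real.rpow_neg hk.le]
    ring
  let loc : Fin (m + 1) → Set ℝ := fun i => if i = 0 then A' else Set.Icc (-X) X
  let B : Fin (m + 1) → Set Pt := fun i =>
    loc i ×ˢ markSlab (e * (i : ℕ)) (e * ((i : ℕ) + 1))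
  have hloc : ∀ i, MeasurableSet (loc i) := fun i => by
    simp only [loc]; split_ifs; exacts [hA'm, measurableSet_Icc]
  have hloc_sub : ∀ i, loc i ⊆ Set.Icc (-X) X := fun i => by
    simp only [loc]; split_ifs
    · exact Set.inter_subset_right.trans (Set.Icc_subset_Icc (by linarith) hnX)
    · exact subset_rfl
  have hBm : ∀ i, MeasurableSet (B i) := fun i => (hloc i).prod (measurableSet_markSlab _ _)
  have hlt : ∀ i j : Fin (m + 1), i < j → ∀ p ∈ B i, ∀ p' ∈ B j, p.2 < p'.2 := by
    intro i j hij p hp p' hp'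
    have h1 : (p.2 : ℝ) ≤ e * ((i : ℕ) + 1) := hp.2.2
    have h2 : e * (j : ℕ) < (p'.2 : ℝ) := hp'.2.1
    have h3 : ((i : ℕ) : ℝ) + 1 ≤ ((j : ℕ) : ℝ) := by exact_mod_cast hij
    have h4 : e * ((i : ℕ) + 1) ≤ e * (j : ℕ) := by gcongr
    exact_mod_cast (h1.trans h4).trans_lt h2
  have hub : ∀ i : Fin (m + 1), e * ((i : ℕ) + 1) ≤ b := by
    intro i
    rw [← heb]
    have : ((i : ℕ) : ℝ) ≤ m := by exact_mod_cast Nat.lt_succ_iff.mp i.2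
    gcongr
  have hdis : Pairwise fun i j => Disjoint (B i) (B j) := by
    intro i j hij
    rw [Set.disjoint_left]
    intro p hp hp'
    rcases lt_or_gt_of_ne hij with h | h
    · exact lt_irrefl _ (hlt i j h p hp p hp')
    · exact lt_irrefl _ (hlt j i h p hp' p hp)
  have hvol : ∀ i, volume (B i) = volume (loc i) * ENNReal.ofReal e := by
    intro i
    simp only [B]
    rw [Measure.volume_eq_prod, Measure.prod_prod, volume_markSlab (by positivity)
      ((hub i).trans hb1)]
    congr 2
    ring
  let S : Set Pt := {p | p.1 ∈ Set.Icc (-X) X}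
  have hSm : MeasurableSet S := measurable_fst measurableSet_Icc
  have hSv : volume S = ENNReal.ofReal (2 * X) := by
    have : S = Set.Icc (-X) X ×ˢ Set.univ := by
      ext p; simp [S]
    rw [this, Measure.volume_eq_prod, Measure.prod_prod, Real.volume_Icc, measure_univ, mul_one]
    congr 1
    ring
  have hmain := mul_prod_le_degSum (γ := γ) (γ' := γ') (β := β) (A := A) (k := k) (S := S)
    hP hP' hindep hk1 hBm hdis
    (fun i => volume_ne_top_of_subset (a := -X) (b := X) fun p hp => hloc_sub i hp.1)
    (fun p hp => by
      have : p.1 ∈ A' := by simpa [B, loc] using hp.1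
      exact this.1)
    (fun i hi => hlt 0 i (Fin.pos_iff_ne_zero.mpr hi)) hSm
    (fun i p hp p' hp' => F_le hγ0 hγ'0 hβ hX0 (hloc_sub i hp.1) hp' (hp.2.2.trans (hub i)))
  refine le_trans ?_ hmain
  have hhalf : 1 / 2 ≤ μ {ω | (k : ℕ∞) ≤ (P' ω).count S} := by
    refine hP'.half_le_measure_le_count hSm (hSv ▸ ENNReal.ofReal_ne_top) ?_
    rw [hSv, ENNReal.toReal_ofReal (by positivity), hX, hL]
    field_simp
    linarith
  have hprod : ∏ i, ((r : ℝ≥0∞) * volume (B i)) =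
      ENNReal.ofReal ((r * (a * e)) * (r * (2 * X * e)) ^ m) := by
    rw [Fin.prod_univ_succ]
    have h0 : (r : ℝ≥0∞) * volume (B 0) = ENNReal.ofReal (r * (a * e)) := by
      rw [hvol]
      simp only [loc, if_true]
      rw [← ENNReal.ofReal_toReal hA't, ← ha, ← ENNReal.ofReal_coe_nnreal,
        ENNReal.ofReal_mul (by positivity), ENNReal.ofReal_mul (by positivity)]
    have hs : ∀ i : Fin m, (r : ℝ≥0∞) * volume (B i.succ) =
        ENNReal.ofReal (r * (2 * X * e)) := by
      intro i
      rw [hvol]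
      simp only [loc, Fin.succ_ne_zero, if_false]
      rw [Real.volume_Icc, ← ENNReal.ofReal_coe_nnreal, ENNReal.ofReal_mul (by positivity),
        ENNReal.ofReal_mul (by positivity)]
      congr 3
      ring
    rw [h0, Finset.prod_congr rfl fun i _ => hs i, Finset.prod_const, Finset.card_univ,
      Fintype.card_fin, ← ENNReal.ofReal_pow (by positivity), ← ENNReal.ofReal_mul (by positivity)]
  rw [hprod]
  refine le_trans (le_of_eq ?_) (mul_le_mul_left hhalf _)
  have h2 : (1 / 2 : ℝ≥0∞) = ENNReal.ofReal (1 / 2) := by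
    rw [ENNReal.ofReal_div_of_pos (by norm_num)]; simp
  rw [h2, ← ENNReal.ofReal_mul (by positivity)]
  congr 1
  have hpow : (k : ℝ) ^ ((m : ℝ) - (m + 1) / γ) =
      (k : ℝ) ^ (-(1 / γ)) * ((k : ℝ) * (k : ℝ) ^ (-(1 / γ))) ^ m := by
    rw [mul_pow, ← Real.rpow_natCast, ← Real.rpow_natCast, ← Real.rpow_mul hk.le,
      ← Real.rpow_add hk, ← Real.rpow_add hk]
    congr 1
    field_simp
    ring
  rw [hpow, hde, hX]
  rw [show (r : ℝ) * (2 * (L * k) * (d * (k : ℝ) ^ (-(1 / γ)))) =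
    (r * (2 * L * d)) * (k * (k : ℝ) ^ (-(1 / γ))) by ring, mul_pow _ (_ * _)]
  ring

end Lower

/-! ### The exponent -/

/-- Taking logarithms, log f(k) / log k differs from α by at most a constant over log k. -/
lemma tendsto_log_div_log {f : ℕ → ℝ} {c C α : ℝ} (hc : 0 < c)
    (h1 : ∀ᶠ k : ℕ in atTop, c * (k : ℝ) ^ α ≤ f k)
    (h2 : ∀ᶠ k : ℕ in atTop, f k ≤ C * (k : ℝ) ^ α) :
    Tendsto (fun k : ℕ => Real.log (f k) / Real.log k) atTop (𝓝 α) := by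
  have hlog : Tendsto (fun k : ℕ => Real.log (k : ℝ)) atTop atTop :=
    Real.tendsto_log_atTop.comp tendsto_natCast_atTop_atTop
  have hlim : ∀ x : ℝ, Tendsto (fun k : ℕ => x / Real.log (k : ℝ) + α) atTop (𝓝 α) := by
    intro x
    simpa using (hlog.const_div_atTop x).add_const α
  refine tendsto_of_tendsto_of_tendsto_of_le_of_le' (hlim (Real.log c)) (hlim (Real.log C)) ?_ ?_
  · filter_upwards [h1, eventually_gt_atTop 1] with k hk hk1
    have hk0 : (1 : ℝ) < k := by exact_mod_cast hk1
    have hl : 0 < Real.log k := Real.log_pos hk0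
    have hp : 0 < (k : ℝ) ^ α := by positivity
    rw [le_div_iff₀ hl, add_mul, div_mul_cancel₀ _ hl.ne', ← Real.log_rpow (by linarith),
      ← Real.log_mul hc.ne' hp.ne']
    exact Real.log_le_log (by positivity) hk
  · filter_upwards [h1, h2, eventually_gt_atTop 1] with k hk hk' hk1
    have hk0 : (1 : ℝ) < k := by exact_mod_cast hk1
    have hl : 0 < Real.log k := Real.log_pos hk0
    have hp : 0 < (k : ℝ) ^ α := by positivity
    have hf : 0 < f k := lt_of_lt_of_le (by positivity) hk
    -- The sign of C is not assumed; it follows from the positive lower bound on f.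
    have hC : 0 < C := by
      by_contra! hC
      exact absurd (hf.trans_le hk') (not_lt.mpr (mul_nonpos_of_nonpos_of_nonneg hC hp.le))
    rw [div_le_iff₀ hl, add_mul, div_mul_cancel₀ _ hl.ne', ← Real.log_rpow (by linarith),
      ← Real.log_mul hC.ne' hp.ne']
    exact Real.log_le_log hf hk'

end

end RCHM

/-! ### From the mean number of high-degree simplices to the tail of the typical degree. -/

theorem mainTheorem4 (m : ℕ) (γ γ' β : ℝ) (lam lam' : ℝ≥0)
    (hγ0 : 0 < γ) (hγ1 : γ < 1) (hγ'0 : 0 < γ') (hγ'1 : γ' < 1 / ((m : ℝ) + 1))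
    (hβ : 0 < β) (hlam0 : 0 < lam) (hlam1 : lam < 1) (hlam'0 : 0 < lam') (hlam'1 : lam' < 1)
    {Ω : Type*} [MeasurableSpace Ω] (μ : Measure Ω) [IsProbabilityMeasure μ]
    (P P' : Ω → RCHM.Config)
    (hP : RCHM.IsPoissonProcess μ P lam) (hP' : RCHM.IsPoissonProcess μ P' lam')
    (hindep : IndepFun P P' μ)
    (A : Set ℝ) (hA : MeasurableSet A) (hA1 : volume A = 1) :
    Tendsto (fun k : ℕ =>
        Real.log (RCHM.typicalDegTail γ γ' β m A μ P P' k).toReal / Real.log (k : ℝ))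
      atTop (𝓝 ((m : ℝ) - ((m : ℝ) + 1) / γ)) := by
  have hI := RCHM.simplexIntensity_ne_top (m := m) hγ1 hγ'1 hβ hlam'0.ne' hP hP' hindep hA
    (by simp [hA1])
  obtain ⟨c, hc0, hc⟩ := RCHM.exists_le_degSum (m := m) hγ0 hγ'0 hβ hlam0.ne' hlam'0.ne' hP hP'
    hindep hA (by simp [hA1])
  obtain ⟨C, hC⟩ := RCHM.exists_degSum_le (m := m) hγ0 hγ1 hγ'0 hγ'1 hβ hlam'0.ne' hP hP'
    hindep hA (by simp [hA1])
  set I := RCHM.simplexIntensity γ γ' β m A μ P P' with hIdef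
  have hle : ∀ k : ℕ, 1 ≤ k → RCHM.degSum γ γ' β m A μ P P' k ≤ I := fun k hk => by
    rw [hIdef, RCHM.simplexIntensity_eq]
    exact RCHM.degSum_antitone μ P P' hk
  -- The intensity dominates `degSum` at every k ≥ 1, and the lower bound makes one of these
  -- positive.
  have hI0 : I ≠ 0 := by
    obtain ⟨k, hk, hk1⟩ := (hc.and (eventually_ge_atTop 1)).exists
    have hk' : (0 : ℝ) < k := by exact_mod_cast hk1
    refine ne_of_gt (lt_of_lt_of_le ?_ (hk.trans (hle k hk1)))
    rw [ENNReal.ofReal_pos]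
    positivity
  have hIr : 0 < I.toReal := ENNReal.toReal_pos hI0 hI
  have hT : ∀ k, (RCHM.typicalDegTail γ γ' β m A μ P P' k).toReal =
      I.toReal⁻¹ * (RCHM.degSum γ γ' β m A μ P P' k).toReal := fun k => by
    rw [RCHM.typicalDegTail_eq, ENNReal.toReal_mul, ENNReal.toReal_inv]
  -- `max C 0` appears because C comes without a sign and passing through `ENNReal.ofReal` truncates
  -- at 0.
  refine RCHM.tendsto_log_div_log (c := I.toReal⁻¹ * c) (C := I.toReal⁻¹ * max C 0)
    (by positivity) ?_ ?_
  · filter_upwards [hc, eventually_ge_atTop 1] with k hk hk1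
    rw [hT, mul_assoc]
    gcongr
    exact (ENNReal.ofReal_le_iff_le_toReal (ne_top_of_le_ne_top hI (hle k hk1))).mp hk
  · filter_upwards [hC] with k hk
    rw [hT, mul_assoc]
    gcongr
    refine (ENNReal.toReal_mono (by simp) hk).trans ?_
    rw [ENNReal.toReal_ofReal']
    refine max_le ?_ (by positivity)
    gcongr
    exact le_max_left _ _
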